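/- **Setting.** Consider the three-sorted (action, situation, object) first-order language of the situation calculus, with the symbols $do$, $\preceq$, $S_0$, $Poss$, action functions with object arguments, finitely many fluents $F(\bar x,s)$ ($\bar x$ of sort object, $s$ of sort situation), object constants, and static predicates and functions on objects. For a theory (set of sentences) $T$ let $\mathrm{sig}(T)$ be the set of non-logical symbols occurring in $T$; $\models$ and $\equiv$ are semantic entailment and equivalence. A formula is *uniform* in a situation term $S$ if it has no quantifiers over situations, no equalities between situations, no $Poss$ or $\preceq$, and every fluent in it has situation argument $S$. A family $(T_j)_{j\in J}$, $|J|\ge 2$, is a *$\Delta$-decomposition* of $T$ if $\Delta\subseteq\mathrm{sig}(T)$, $\mathrm{sig}(T_i)\cap\mathrm{sig}(T_j)=\Delta$ for $i\ne j$, $\mathrm{sig}(T_j)\neq\Delta$ for all $j$, $\bigcup_j\mathrm{sig}(T_j)=\mathrm{sig}(T)$ and $T\equiv\bigcup_jT_j$. Two theories are *$\Delta$-inseparable* if they entail the same first-order sentences $\varphi$ with $\mathrm{sig}(\varphi)\subseteq\Delta$. A signature is *fluent-free* if it contains no fluent. **Basic action theories.** Let $\mathcal D$ be a basic action theory with initial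 theory $D_{S_0}$, a set of first-order sentences uniform in $S_0$, and a set $D_{ss}$ of successor state axioms, one for each fluent $F$, $$\forall\bar x,a,s\,\bigl(F(\bar x,do(a,s))\leftrightarrow\gamma_F^+(\bar x,a,s)\vee F(\bar x,s)\wedge\neg\gamma_F^-(\bar x,a,s)\bigr),$$ where $\gamma_F^{\pm}$ are finite disjunctions of formulas $\exists\bar y\,(a=B(\bar t)\wedge\phi(\bar x,\bar y,s))$ with $\bar t$ object terms over $\bar x,\bar y$ and $\phi$ uniform in $s$; such a $B$ is *in active position*. Precondition axioms are trivial. $\mathcal D$ is *local-effect* if in every such disjunct each variable of $\bar x$ is one of the arguments $\bar t$. **Progression.** Let $\alpha=A(\bar c)$ be a ground action term with constants $\bar c=\langle c_1,\dots,c_k\rangle$, and $S_\alpha=do(\alpha,S_0)$. Substitute $\alpha$ for $a$ in $\gamma^\pm_F$ and rewrite equalities of action terms by the unique name axioms for actions (disjuncts with $B\ne A$ become false, $A(\bar c)=A(\bar t)$ becomes $\bar c=\bar t$). Let $\Omega(S_0)$ be the finite set of ground atoms $F(\bar u,S_0)$ such that in some disjunct for $F$ with $B=A$ the equality $\bar c=\bar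 t$ equates each $x_i$ with $u_i$, and let $D_{ss}[\Omega(S_0)]$ consist of the sentences $F(\bar u,S_\alpha)\leftrightarrow\gamma_F^+(\bar u,\alpha,S_0)\vee F(\bar u,S_0)\wedge\neg\gamma_F^-(\bar u,\alpha,S_0)$ (with the rewritten $\gamma_F^\pm$) for $F(\bar u,S_0)\in\Omega(S_0)$. *Forgetting* a ground atom $p=F(\bar u,S_0)$ in $T$ gives $\bigwedge_{\varphi\in T}\varphi^+\vee\bigwedge_{\varphi\in T}\varphi^-$ (for infinite $T$: the set of all $\varphi^+\vee\psi^-$ with $\varphi,\psi\in T$), where $\varphi^{+}$, $\varphi^-$ arise from $\varphi$ by first replacing every atom $F(\bar u',S_0)$ with $(\bar u=\bar u'\wedge p)\vee(\bar u\ne\bar u'\wedge F(\bar u',S_0))$ and then every occurrence of $p$ with true, respectively false; atoms at $S_\alpha$ are not affected. Finitely many atoms are forgotten one after the other. The progression of $D_{S_0}$ with respect to $\alpha$ is $$D_{S_\alpha}=\mathrm{forget}\bigl(D_{ss}[\Omega(S_0)]\cup D_{S_0},\,\Omega(S_0)\bigr)(S_\alpha/S_0),$$ where situation arguments $S_0$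 are replaced with $S_\alpha$; $D_{S_\alpha}(S_0/S_\alpha)$ is obtained by replacing $S_\alpha$ with $S_0$, and is again uniform in $S_0$. **Conditions $(\ast)$ for $(\mathcal D,\alpha)$,** with signatures $\Delta_1,\Delta_2$, theories $\{D_i\}_{i\in I}$, $I\neq\varnothing$, and $\{D'_j\}_{j\in J}$. Put $\Delta_\alpha=\Delta_1\cup\Delta_2\cup\{c_1,\dots,c_k\}$. 1. $\mathcal D$ is local-effect; $\Delta_1,\Delta_2$ are fluent-free and do not contain $do$. 2. $D_{ss}=\bigcup_{i\in I}D_i$ and $\mathrm{sig}(D_n)\cap\mathrm{sig}(D_m)\subseteq\Delta_1\cup\{do\}$ for $n\ne m$. 3. $\{D'_j\}_{j\in J}$ is a $\Delta_2$-decomposition of $D_{S_0}$ into finite theories uniform in $S_0$ with $\mathrm{sig}(D'_j)\setminus\Delta_\alpha\ne\varnothing$ for all $j$. 4. Every fluent of $\mathrm{sig}(D_{ss})$ is in $\mathrm{sig}(D_{S_0})$. 5. For every $i\in I$ there is $j\in J$ with $\mathrm{sig}(D_i)\cap\mathrm{sig}(D_{S_0})\subseteq\mathrm{sig}(D'_j)$.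 The *strong conditions* for $(\mathcal D,\alpha)$ are $(\ast)$ together with: 6. no action function is in $\Delta_1$; 7. $\{c_1,\dots,c_k\}\subseteq\mathrm{sig}(D'_j)$ whenever $A$ is in active position in the successor state axiom of a fluent $F\in\mathrm{sig}(D'_j)$; 8. $\Delta_1\subseteq\Delta_2$. **Theorem.** Assume the strong conditions for $(\mathcal D,\alpha)$. Then $D_{S_\alpha}(S_0/S_\alpha)$ has a $\Delta_2$-decomposition $\{D''_j\}_{j\in J}$ such that: (a) if the $D'_j$ are pairwise $\Delta_2$-inseparable, then so are the $D''_j$; (b) the conditions $(\ast)$ hold for $\alpha$, and indeed for every ground action $\beta$ for which they hold in $\mathcal D$ with $\{D_i\}$, $\{D'_j\}$, for the basic action theory with the same successor state axioms and the initial theory $D_{S_\alpha}(S_0/S_\alpha)$, with $\{D_i\}$ and $\{D''_j\}$. The same is true of the strong conditions, and of pairwise $\Delta_\beta$-inseparability of the components. Consequently the argument can be iterated: if the strong conditions hold in $\mathcal D$ for each of the ground actions $\beta_1,\dots,\beta_n$, then the initial theory obtained by progressing successively with respect to $\beta_1,\dots,\beta_n$ (each time replacing the new situation term with $S_0$) has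 a $\Delta_2$-decomposition indexed by $J$, whose components are pairwise $\Delta_2$-inseparable if the $D'_j$ are. -/

import Mathlib

/-- The situation-calculus alphabet besides `do`, `≼`, `S₀`, `Poss`: action functions, fluents
(`fluentArity F` is the number of object arguments; the last argument, of sort situation, is
implicit), object constants, static predicates and static functions. -/
structure SitLang where
  Action : Type
  actionArity : Action → ℕ
  Fluent : Type
  fluentArity : Fluent → ℕ
  Const : Type
  Pred : Type
  predArity : Pred → ℕ
  Func : Type
  funcArity : Func → ℕ

namespace SitCalc

/-- Non-logical symbols. -/
inductive Symb (L : SitLang) : Type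
  | doSym
  | prec
  | s0
  | poss
  | action (A : L.Action)
  | fluent (F : L.Fluent)
  | const (c : L.Const)
  | pred (P : L.Pred)
  | func (f : L.Func)

/-! ### Three-sorted first-order syntax

`n`, `a`, `s` are the numbers of free variables of sort object, action and situation; a quantifier
binds the last variable of its sort. -/

inductive ObjTerm (L : SitLang) (n : ℕ) : Type
  | var (i : Fin n)
  | const (c : L.Const)
  | func (f : L.Func) (ts : Fin (L.funcArity f) → ObjTerm L n)

inductive ActTerm (L : SitLang) (n a : ℕ) : Type
  | var (i : Fin a)
  | app (A : L.Action) (ts : Fin (L.actionArity A) → ObjTerm L n)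

inductive SitTerm (L : SitLang) (n a s : ℕ) : Type
  | var (i : Fin s)
  | s0
  | doTerm (t : ActTerm L n a) (u : SitTerm L n a s)

inductive Formula (L : SitLang) : ℕ → ℕ → ℕ → Type
  | falsum {n a s : ℕ} : Formula L n a s
  | eqObj {n a s : ℕ} (t t' : ObjTerm L n) : Formula L n a s
  | eqAct {n a s : ℕ} (t t' : ActTerm L n a) : Formula L n a s
  | eqSit {n a s : ℕ} (u u' : SitTerm L n a s) : Formula L n a s
  | pred {n a s : ℕ} (P : L.Pred) (ts : Fin (L.predArity P) → ObjTerm L n) : Formula L n a s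
  | fluent {n a s : ℕ} (F : L.Fluent) (ts : Fin (L.fluentArity F) → ObjTerm L n)
      (u : SitTerm L n a s) : Formula L n a s
  | poss {n a s : ℕ} (t : ActTerm L n a) (u : SitTerm L n a s) : Formula L n a s
  | prec {n a s : ℕ} (u u' : SitTerm L n a s) : Formula L n a s
  | imp {n a s : ℕ} (φ ψ : Formula L n a s) : Formula L n a s
  | allObj {n a s : ℕ} (φ : Formula L (n + 1) a s) : Formula L n a s
  | allAct {n a s : ℕ} (φ : Formula L n (a + 1) s) : Formula L n a s
  | allSit {n a s : ℕ} (φ : Formula L n a (s + 1)) : Formula L n a s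

abbrev Sentence (L : SitLang) : Type := Formula L 0 0 0

abbrev Theory (L : SitLang) : Type := Set (Sentence L)

variable {L : SitLang}

namespace Formula

variable {n a s : ℕ}

def neg (φ : Formula L n a s) : Formula L n a s := imp φ falsum

def verum : Formula L n a s := neg falsum

def or (φ ψ : Formula L n a s) : Formula L n a s := imp (neg φ) ψ

def and (φ ψ : Formula L n a s) : Formula L n a s := neg (imp φ (neg ψ))

def iff (φ ψ : Formula L n a s) : Formula L n a s := and (imp φ ψ) (imp ψ φ)

def exObj (φ : Formula L (n + 1) a s) : Formula L n a s := neg (allObj (neg φ))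

/-- Finite disjunction; the empty one is false. -/
def bigOr (l : List (Formula L n a s)) : Formula L n a s := l.foldr or falsum

/-- Finite conjunction; the empty one is true. -/
def bigAnd (l : List (Formula L n a s)) : Formula L n a s := l.foldr and verum

/-- Equality of two vectors of object terms. -/
def eqVec {k : ℕ} (t t' : Fin k → ObjTerm L n) : Formula L n a s :=
  bigAnd (List.ofFn fun i => eqObj (t i) (t' i))

/-- Existential quantification over the last `m` object variables. -/
def exObjs : (m : ℕ) → Formula L (n + m) a s → Formula L n a s
  | 0, φ => φ
  | m + 1, φ => exObjs m (exObj φ)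

/-- Universal quantification over all `n` object variables. -/
def allObjs : (n : ℕ) → Formula L n a s → Formula L 0 a s
  | 0, φ => φ
  | n + 1, φ => allObjs n (allObj φ)

end Formula

/-! ### Signatures -/

def ObjTerm.sig {n : ℕ} : ObjTerm L n → Set (Symb L)
  | .var _ => ∅
  | .const c => {.const c}
  | .func f ts => {.func f} ∪ ⋃ i, (ts i).sig

def ActTerm.sig {n a : ℕ} : ActTerm L n a → Set (Symb L)
  | .var _ => ∅
  | .app A ts => {.action A} ∪ ⋃ i, (ts i).sig

def SitTerm.sig {n a s : ℕ} : SitTerm L n a s → Set (Symb L)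
  | .var _ => ∅
  | .s0 => {.s0}
  | .doTerm t u => {.doSym} ∪ t.sig ∪ u.sig

def Formula.sig : {n a s : ℕ} → Formula L n a s → Set (Symb L)
  | _, _, _, .falsum => ∅
  | _, _, _, .eqObj t t' => t.sig ∪ t'.sig
  | _, _, _, .eqAct t t' => t.sig ∪ t'.sig
  | _, _, _, .eqSit u u' => u.sig ∪ u'.sig
  | _, _, _, .pred P ts => {.pred P} ∪ ⋃ i, (ts i).sig
  | _, _, _, .fluent F ts u => {.fluent F} ∪ (⋃ i, (ts i).sig) ∪ u.sig
  | _, _, _, .poss t u => {.poss} ∪ t.sig ∪ u.sig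
  | _, _, _, .prec u u' => {.prec} ∪ u.sig ∪ u'.sig
  | _, _, _, .imp φ ψ => φ.sig ∪ ψ.sig
  | _, _, _, .allObj φ => φ.sig
  | _, _, _, .allAct φ => φ.sig
  | _, _, _, .allSit φ => φ.sig

/-- The set of non-logical symbols occurring in a theory. -/
def Theory.sig (T : Theory L) : Set (Symb L) := ⋃ φ ∈ T, Formula.sig φ

/-! ### Semantics -/

/-- Three-sorted structures (with non-empty domains). -/
structure Str (L : SitLang) : Type 1 where
  Obj : Type
  Act : Type
  Sit : Type
  [obj_nonempty : Nonempty Obj]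
  [act_nonempty : Nonempty Act]
  [sit_nonempty : Nonempty Sit]
  const : L.Const → Obj
  func : (f : L.Func) → (Fin (L.funcArity f) → Obj) → Obj
  pred : (P : L.Pred) → (Fin (L.predArity P) → Obj) → Prop
  action : (A : L.Action) → (Fin (L.actionArity A) → Obj) → Act
  s0 : Sit
  doFun : Act → Sit → Sit
  prec : Sit → Sit → Prop
  poss : Act → Sit → Prop
  fluent : (F : L.Fluent) → (Fin (L.fluentArity F) → Obj) → Sit → Prop

def ObjTerm.eval (M : Str L) {n : ℕ} (vo : Fin n → M.Obj) : ObjTerm L n → M.Obj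
  | .var i => vo i
  | .const c => M.const c
  | .func f ts => M.func f fun i => (ts i).eval M vo

def ActTerm.eval (M : Str L) {n a : ℕ} (vo : Fin n → M.Obj) (va : Fin a → M.Act) :
    ActTerm L n a → M.Act
  | .var i => va i
  | .app A ts => M.action A fun i => (ts i).eval M vo

def SitTerm.eval (M : Str L) {n a s : ℕ} (vo : Fin n → M.Obj) (va : Fin a → M.Act)
    (vs : Fin s → M.Sit) : SitTerm L n a s → M.Sit
  | .var i => vs i
  | .s0 => M.s0
  | .doTerm t u => M.doFun (t.eval M vo va) (u.eval M vo va vs)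

def Formula.Holds (M : Str L) : {n a s : ℕ} → Formula L n a s →
    (Fin n → M.Obj) → (Fin a → M.Act) → (Fin s → M.Sit) → Prop
  | _, _, _, .falsum, _, _, _ => False
  | _, _, _, .eqObj t t', vo, _, _ => t.eval M vo = t'.eval M vo
  | _, _, _, .eqAct t t', vo, va, _ => t.eval M vo va = t'.eval M vo va
  | _, _, _, .eqSit u u', vo, va, vs => u.eval M vo va vs = u'.eval M vo va vs
  | _, _, _, .pred P ts, vo, _, _ => M.pred P fun i => (ts i).eval M vo
  | _, _, _, .fluent F ts u, vo, va, vs =>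
      M.fluent F (fun i => (ts i).eval M vo) (u.eval M vo va vs)
  | _, _, _, .poss t u, vo, va, vs => M.poss (t.eval M vo va) (u.eval M vo va vs)
  | _, _, _, .prec u u', vo, va, vs => M.prec (u.eval M vo va vs) (u'.eval M vo va vs)
  | _, _, _, .imp φ ψ, vo, va, vs => φ.Holds M vo va vs → ψ.Holds M vo va vs
  | _, _, _, .allObj φ, vo, va, vs =>
      ∀ x : M.Obj, φ.Holds M (Fin.snoc (α := fun _ => M.Obj) vo x) va vs
  | _, _, _, .allAct φ, vo, va, vs =>
      ∀ x : M.Act, φ.Holds M vo (Fin.snoc (α := fun _ => M.Act) va x) vs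
  | _, _, _, .allSit φ, vo, va, vs =>
      ∀ x : M.Sit, φ.Holds M vo va (Fin.snoc (α := fun _ => M.Sit) vs x)

def Str.Models (M : Str L) (T : Theory L) : Prop :=
  ∀ φ ∈ T, Formula.Holds M φ Fin.elim0 Fin.elim0 Fin.elim0

def Theory.Entails (T : Theory L) (φ : Sentence L) : Prop :=
  ∀ M : Str L, M.Models T → M.Models {φ}

def Theory.Equiv (T T' : Theory L) : Prop := ∀ M : Str L, M.Models T ↔ M.Models T'

/-! ### Decomposability and inseparability -/

/-- The family `C` (of at least two theories) is a `Δ`-decomposition of `T`. -/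
structure IsDecomposition (Δ : Set (Symb L)) (T : Theory L) {J : Type*} (C : J → Theory L) :
    Prop where
  nontrivial : Nontrivial J
  subset_sig : Δ ⊆ T.sig
  inter_eq : ∀ i j, i ≠ j → (C i).sig ∩ (C j).sig = Δ
  sig_ne : ∀ j, (C j).sig ≠ Δ
  union_eq : ⋃ j, (C j).sig = T.sig
  equiv : T.Equiv (⋃ j, C j)

/-- `Δ`-inseparability: the same first-order consequences in the signature `Δ`. -/
def Inseparable (Δ : Set (Symb L)) (T T' : Theory L) : Prop :=
  ∀ φ : Sentence L, φ.sig ⊆ Δ → (T.Entails φ ↔ T'.Entails φ)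

def PairwiseInseparable (Δ : Set (Symb L)) {J : Type*} (C : J → Theory L) : Prop :=
  ∀ i j, i ≠ j → Inseparable Δ (C i) (C j)

/-! ### Substitution -/

def ObjTerm.subst {n n' : ℕ} (σ : Fin n → ObjTerm L n') : ObjTerm L n → ObjTerm L n'
  | .var i => σ i
  | .const c => .const c
  | .func f ts => .func f fun i => (ts i).subst σ

def ActTerm.subst {n a n' a' : ℕ} (σ : Fin n → ObjTerm L n') (τ : Fin a → ActTerm L n' a') :
    ActTerm L n a → ActTerm L n' a'
  | .var i => τ i
  | .app A ts => .app A fun i => (ts i).subst σ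

def SitTerm.subst {n a s n' a' s' : ℕ} (σ : Fin n → ObjTerm L n')
    (τ : Fin a → ActTerm L n' a') (ρ : Fin s → SitTerm L n' a' s') :
    SitTerm L n a s → SitTerm L n' a' s'
  | .var i => ρ i
  | .s0 => .s0
  | .doTerm t u => .doTerm (t.subst σ τ) (u.subst σ τ ρ)

/-! Weakening by one new (last) variable. -/

def ObjTerm.wkObj {n : ℕ} (t : ObjTerm L n) : ObjTerm L (n + 1) :=
  t.subst fun i => .var i.castSucc

def ActTerm.wkObj {n a : ℕ} (t : ActTerm L n a) : ActTerm L (n + 1) a :=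
  t.subst (fun i => .var i.castSucc) .var

def ActTerm.wkAct {n a : ℕ} (t : ActTerm L n a) : ActTerm L n (a + 1) :=
  t.subst .var fun i => .var i.castSucc

def SitTerm.wkObj {n a s : ℕ} (u : SitTerm L n a s) : SitTerm L (n + 1) a s :=
  u.subst (fun i => .var i.castSucc) .var .var

def SitTerm.wkAct {n a s : ℕ} (u : SitTerm L n a s) : SitTerm L n (a + 1) s :=
  u.subst .var (fun i => .var i.castSucc) .var

def SitTerm.wkSit {n a s : ℕ} (u : SitTerm L n a s) : SitTerm L n a (s + 1) :=
  u.subst .var .var fun i => .var i.castSucc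

def Formula.subst : {n a s n' a' s' : ℕ} → Formula L n a s → (Fin n → ObjTerm L n') →
    (Fin a → ActTerm L n' a') → (Fin s → SitTerm L n' a' s') → Formula L n' a' s'
  | _, _, _, _, _, _, .falsum, _, _, _ => .falsum
  | _, _, _, _, _, _, .eqObj t t', σ, _, _ => .eqObj (t.subst σ) (t'.subst σ)
  | _, _, _, _, _, _, .eqAct t t', σ, τ, _ => .eqAct (t.subst σ τ) (t'.subst σ τ)
  | _, _, _, _, _, _, .eqSit u u', σ, τ, ρ => .eqSit (u.subst σ τ ρ) (u'.subst σ τ ρ)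
  | _, _, _, _, _, _, .pred P ts, σ, _, _ => .pred P fun i => (ts i).subst σ
  | _, _, _, _, _, _, .fluent F ts u, σ, τ, ρ =>
      .fluent F (fun i => (ts i).subst σ) (u.subst σ τ ρ)
  | _, _, _, _, _, _, .poss t u, σ, τ, ρ => .poss (t.subst σ τ) (u.subst σ τ ρ)
  | _, _, _, _, _, _, .prec u u', σ, τ, ρ => .prec (u.subst σ τ ρ) (u'.subst σ τ ρ)
  | _, _, _, _, _, _, .imp φ ψ, σ, τ, ρ => .imp (φ.subst σ τ ρ) (ψ.subst σ τ ρ)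
  | _, _, _, n', _, _, .allObj φ, σ, τ, ρ =>
      .allObj (φ.subst
        (Fin.snoc (α := fun _ => ObjTerm L (n' + 1)) (fun i => (σ i).wkObj) (.var (Fin.last n')))
        (fun i => (τ i).wkObj) (fun i => (ρ i).wkObj))
  | _, _, _, n', a', _, .allAct φ, σ, τ, ρ =>
      .allAct (φ.subst σ
        (Fin.snoc (α := fun _ => ActTerm L n' (a' + 1)) (fun i => (τ i).wkAct)
          (.var (Fin.last a')))
        (fun i => (ρ i).wkAct))
  | _, _, _, n', a', s', .allSit φ, σ, τ, ρ =>
      .allSit (φ.subst σ τ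
        (Fin.snoc (α := fun _ => SitTerm L n' a' (s' + 1)) (fun i => (ρ i).wkSit)
          (.var (Fin.last s'))))

/-! ### Uniform formulas -/

/-- `φ` is uniform in the situation term `S`: no quantifiers over situations, no equalities between
situation terms, no `Poss` or `≼`, and `S` is the situation argument of every fluent. -/
def Formula.Uniform : {n a s : ℕ} → Formula L n a s → SitTerm L n a s → Prop
  | _, _, _, .falsum, _ => True
  | _, _, _, .eqObj _ _, _ => True
  | _, _, _, .eqAct _ _, _ => True
  | _, _, _, .eqSit _ _, _ => False
  | _, _, _, .pred _ _, _ => True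
  | _, _, _, .fluent _ _ u, S => u = S
  | _, _, _, .poss _ _, _ => False
  | _, _, _, .prec _ _, _ => False
  | _, _, _, .imp φ ψ, S => φ.Uniform S ∧ ψ.Uniform S
  | _, _, _, .allObj φ, S => φ.Uniform S.wkObj
  | _, _, _, .allAct φ, S => φ.Uniform S.wkAct
  | _, _, _, .allSit _, _ => False

open Classical in
/-- `φ(S'/S)`: every situation argument `S` is replaced with `S'`. -/
noncomputable def Formula.replaceSit : {n a s : ℕ} → Formula L n a s →
    (S S' : SitTerm L n a s) → Formula L n a s
  | _, _, _, .falsum, _, _ => .falsum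
  | _, _, _, .eqObj t t', _, _ => .eqObj t t'
  | _, _, _, .eqAct t t', _, _ => .eqAct t t'
  | _, _, _, .eqSit u u', S, S' =>
      .eqSit (if u = S then S' else u) (if u' = S then S' else u')
  | _, _, _, .pred P ts, _, _ => .pred P ts
  | _, _, _, .fluent F ts u, S, S' => .fluent F ts (if u = S then S' else u)
  | _, _, _, .poss t u, S, S' => .poss t (if u = S then S' else u)
  | _, _, _, .prec u u', S, S' =>
      .prec (if u = S then S' else u) (if u' = S then S' else u')
  | _, _, _, .imp φ ψ, S, S' => .imp (φ.replaceSit S S') (ψ.replaceSit S S')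
  | _, _, _, .allObj φ, S, S' => .allObj (φ.replaceSit S.wkObj S'.wkObj)
  | _, _, _, .allAct φ, S, S' => .allAct (φ.replaceSit S.wkAct S'.wkAct)
  | _, _, _, .allSit φ, S, S' => .allSit (φ.replaceSit S.wkSit S'.wkSit)

noncomputable def Theory.replaceSit (T : Theory L) (S S' : SitTerm L 0 0 0) : Theory L :=
  (fun φ : Sentence L => φ.replaceSit S S') '' T

/-! ### Forgetting ground atoms -/

/-- A pair `⟨F, t̄⟩` stands for the ground atom `F(t̄, S₀)`, with `t̄` a vector of constants. -/
abbrev GroundAtom (L : SitLang) : Type := (F : L.Fluent) × (Fin (L.fluentArity F) → L.Const)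

/-- The atomic formula `F(t̄, S₀)`. -/
def GroundAtom.toFormula {n a s : ℕ} (p : GroundAtom L) : Formula L n a s :=
  .fluent p.1 (fun i => .const (p.2 i)) .s0

open Classical in
/-- `φ[F(t̄, S₀)]`: every atom `F(t̄', S₀)` is replaced with
`[t̄ = t̄' ∧ F(t̄, S₀)] ∨ [t̄ ≠ t̄' ∧ F(t̄', S₀)]`. Atoms at a situation term other than `S₀` are
different atoms and stay as they are. -/
noncomputable def Formula.bracket (p : GroundAtom L) :
    {n a s : ℕ} → Formula L n a s → Formula L n a s
  | _, _, _, .falsum => .falsum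
  | _, _, _, .eqObj t t' => .eqObj t t'
  | _, _, _, .eqAct t t' => .eqAct t t'
  | _, _, _, .eqSit u u' => .eqSit u u'
  | _, _, _, .pred P ts => .pred P ts
  | n, _, _, .fluent F ts u =>
      if h : F = p.1 ∧ u = .s0 then
        let e := Formula.eqVec (fun i => (ObjTerm.const (p.2 i) : ObjTerm L n))
          (fun i => ts (Fin.cast (congrArg L.fluentArity h.1).symm i))
        .or (.and e p.toFormula) (.and (.neg e) (.fluent F ts u))
      else .fluent F ts u
  | _, _, _, .poss t u => .poss t u
  | _, _, _, .prec u u' => .prec u u'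
  | _, _, _, .imp φ ψ => .imp (φ.bracket p) (ψ.bracket p)
  | _, _, _, .allObj φ => .allObj (φ.bracket p)
  | _, _, _, .allAct φ => .allAct (φ.bracket p)
  | _, _, _, .allSit φ => .allSit (φ.bracket p)

open Classical in
/-- Every occurrence of the ground atom `p` is replaced with the truth value `b`. -/
noncomputable def Formula.setAtom (p : GroundAtom L) (b : Bool) :
    {n a s : ℕ} → Formula L n a s → Formula L n a s
  | _, _, _, .falsum => .falsum
  | _, _, _, .eqObj t t' => .eqObj t t'
  | _, _, _, .eqAct t t' => .eqAct t t'
  | _, _, _, .eqSit u u' => .eqSit u u'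
  | _, _, _, .pred P ts => .pred P ts
  | _, _, _, .fluent F ts u =>
      if Formula.fluent F ts u = p.toFormula then
        (if b = true then .verum else .falsum)
      else .fluent F ts u
  | _, _, _, .poss t u => .poss t u
  | _, _, _, .prec u u' => .prec u u'
  | _, _, _, .imp φ ψ => .imp (φ.setAtom p b) (ψ.setAtom p b)
  | _, _, _, .allObj φ => .allObj (φ.setAtom p b)
  | _, _, _, .allAct φ => .allAct (φ.setAtom p b)
  | _, _, _, .allSit φ => .allSit (φ.setAtom p b)

/-- Forgetting a ground atom: with `φ⁺`, `φ⁻` the results of replacing `p` in `φ[p]` with true and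
with false, this is `(⋀ φ⁺) ∨ (⋀ φ⁻)`, distributed so that it makes sense for infinite theories. -/
noncomputable def Theory.forget (T : Theory L) (p : GroundAtom L) : Theory L :=
  {χ | ∃ φ ∈ T, ∃ ψ ∈ T,
    χ = ((φ.bracket p).setAtom p true).or ((ψ.bracket p).setAtom p false)}

/-- Forgetting several ground atoms, one after the other. -/
noncomputable def Theory.forgetList (T : Theory L) (ω : List (GroundAtom L)) : Theory L :=
  ω.foldl Theory.forget T

/-! ### Successor state axioms and basic action theories -/

/-- One disjunct `∃ ȳ (a = A(t̄) ∧ φ(x̄, ȳ, s))` of `γ⁺` or `γ⁻`, where `x̄` are the first `n` and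
`ȳ` the last `m` of the object variables and `φ` is uniform in `s`. -/
structure Effect (L : SitLang) (n : ℕ) where
  m : ℕ
  act : L.Action
  args : Fin (L.actionArity act) → ObjTerm L (n + m)
  ctx : Formula L (n + m) 0 1
  ctx_uniform : ctx.Uniform (.var 0)

/-- The disjunct as a formula in `x̄`, `a`, `s`. -/
def Effect.toFormula {n : ℕ} (e : Effect L n) : Formula L n 1 1 :=
  .exObjs e.m (.and (.eqAct (.var 0) (.app e.act e.args)) (e.ctx.subst .var Fin.elim0 .var))

/-- The data of a successor state axiom for the fluent `F`: the disjuncts of `γ⁺` and of `γ⁻`. -/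
structure SSA (L : SitLang) (F : L.Fluent) where
  pos : List (Effect L (L.fluentArity F))
  neg : List (Effect L (L.fluentArity F))

/-- `∀ x̄, a, s (F(x̄, do(a, s)) ↔ γ⁺(x̄, a, s) ∨ F(x̄, s) ∧ ¬ γ⁻(x̄, a, s))`. -/
def SSA.toSentence {F : L.Fluent} (ax : SSA L F) : Sentence L :=
  .allSit (.allAct (.allObjs (L.fluentArity F)
    (.iff (.fluent F .var (.doTerm (.var 0) (.var 0)))
      (.or (.bigOr (ax.pos.map Effect.toFormula))
        (.and (.fluent F .var (.var 0)) (.neg (.bigOr (ax.neg.map Effect.toFormula))))))))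

/-- The action function `A` is in active position of the axiom. -/
def SSA.Active {F : L.Fluent} (ax : SSA L F) (A : L.Action) : Prop :=
  ∃ e ∈ ax.pos ++ ax.neg, e.act = A

/-- The arguments of every action function in active position contain all object variables
of the fluent. -/
def SSA.LocalEffect {F : L.Fluent} (ax : SSA L F) : Prop :=
  ∀ e ∈ ax.pos ++ ax.neg, ∀ i, ∃ k, e.args k = .var (Fin.castAdd e.m i)

/-- A basic action theory over `L`: one successor state axiom for every fluent, and an initial
theory uniform in `S₀`. The foundational axioms, the unique name axioms and the (trivial)
precondition axioms are determined by `L`, so they carry no data. -/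
structure BAT (L : SitLang) where
  ssa : (F : L.Fluent) → SSA L F
  init : Theory L
  init_uniform : ∀ φ ∈ init, Formula.Uniform φ .s0

/-- The set of successor state axioms. -/
def BAT.ssTheory (D : BAT L) : Theory L := Set.range fun F => (D.ssa F).toSentence

def BAT.LocalEffect (D : BAT L) : Prop := ∀ F, (D.ssa F).LocalEffect

/-! ### Progression of local-effect theories -/

/-- A ground action term `A(c̄)` with `c̄` a tuple of constants. -/
structure GroundAction (L : SitLang) where
  act : L.Action
  args : Fin (L.actionArity act) → L.Const

/-- `{c₁, …, c_k}`, as a set of symbols. -/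
def GroundAction.consts (α : GroundAction L) : Set (Symb L) :=
  Set.range fun k => Symb.const (α.args k)

/-- The situation term `S_α = do(α, S₀)`. -/
def GroundAction.sit {n a s : ℕ} (α : GroundAction L) : SitTerm L n a s :=
  .doTerm (.app α.act fun k => .const (α.args k)) .s0

open Classical in
/-- A disjunct after `a` is replaced with `α = A(c̄)` and the equality between action terms is
rewritten with the unique name axioms for actions: `∃ ȳ (c̄ = t̄ ∧ φ(x̄, ȳ, s))` if the action
function of the disjunct is `A`, false otherwise. -/
noncomputable def Effect.resolve {n : ℕ} (α : GroundAction L) (e : Effect L n) :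
    Formula L n 0 1 :=
  if h : e.act = α.act then
    .exObjs e.m (.and
      (.eqVec (fun k => .const (α.args (Fin.cast (congrArg L.actionArity h) k))) e.args) e.ctx)
  else .falsum

/-- `γ(t̄, α, S₀)` for the disjunction `γ` of the effects in `l`, after that rewriting. -/
noncomputable def gammaAt {n : ℕ} (α : GroundAction L) (l : List (Effect L n))
    (t : Fin n → L.Const) : Sentence L :=
  (Formula.bigOr (l.map (Effect.resolve α))).subst (fun i => .const (t i)) Fin.elim0
    (fun _ => .s0)

/-- `F(t̄, do(α, S₀)) ↔ γ⁺(t̄, α, S₀) ∨ F(t̄, S₀) ∧ ¬ γ⁻(t̄, α, S₀)`. -/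
noncomputable def BAT.instAt (D : BAT L) (α : GroundAction L) (p : GroundAtom L) : Sentence L :=
  .iff (.fluent p.1 (fun i => .const (p.2 i)) α.sit)
    (.or (gammaAt α (D.ssa p.1).pos p.2)
      (.and p.toFormula (.neg (gammaAt α (D.ssa p.1).neg p.2))))

/-- The characteristic set `Ω(S₀)` of `α`: the ground atoms `F(t̄, S₀)` such that `x̄ = t̄` appears
in the transformed axiom for `F`, i.e. the equality `c̄ = t̄'` coming from an active position of the
action function of `α` equates every `xᵢ` with `tᵢ`. -/
def BAT.omega (D : BAT L) (α : GroundAction L) : Set (GroundAtom L) :=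
  {p | ∃ e ∈ (D.ssa p.1).pos ++ (D.ssa p.1).neg, ∃ h : e.act = α.act,
    ∀ i, ∃ k, e.args k = .var (Fin.castAdd e.m i) ∧
      p.2 i = α.args (Fin.cast (congrArg L.actionArity h) k)}

theorem BAT.omega_finite [Finite L.Fluent] (D : BAT L) (α : GroundAction L) :
    (D.omega α).Finite := by
  have h : ∀ F : L.Fluent,
      ({t | ∀ i, t i ∈ Set.range α.args} : Set (Fin (L.fluentArity F) → L.Const)).Finite :=
    fun F => Set.Finite.pi' fun _ => Set.finite_range _
  refine (Set.finite_iUnion fun F => (h F).image (Sigma.mk F)).subset ?_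
  rintro ⟨F, t⟩ ⟨e, -, he, ht⟩
  refine Set.mem_iUnion.2 ⟨F, t, fun i => ?_, rfl⟩
  obtain ⟨k, -, hk⟩ := ht i
  exact ⟨_, hk.symm⟩

/-- `Ω(S₀)` as a list. -/
noncomputable def BAT.omegaList [Finite L.Fluent] (D : BAT L) (α : GroundAction L) :
    List (GroundAtom L) :=
  (D.omega_finite α).toFinset.toList

/-- The instantiation `D_ss[Ω(S₀)]`. -/
noncomputable def BAT.inst (D : BAT L) (α : GroundAction L) : Theory L :=
  D.instAt α '' D.omega α

/-- The progression `D_{S_α} = forget(D_ss[Ω(S₀)] ∪ D_{S₀}, Ω(S₀))(S_α/S₀)`. -/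
noncomputable def BAT.progression [Finite L.Fluent] (D : BAT L) (α : GroundAction L) :
    Theory L :=
  (Theory.forgetList (D.inst α ∪ D.init) (D.omegaList α)).replaceSit .s0 α.sit

/-! The progression is uniform in `S_α`, so `D_{S_α}(S₀/S_α)` is again an initial theory. -/

/-- Auxiliary: like `Formula.Uniform`, with the situation arguments `S₀` and `S_α`. -/
def Formula.TwoSit (α : GroundAction L) : {n a s : ℕ} → Formula L n a s → Prop
  | _, _, _, .falsum => True
  | _, _, _, .eqObj _ _ => True
  | _, _, _, .eqAct _ _ => True
  | _, _, _, .eqSit _ _ => False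
  | _, _, _, .pred _ _ => True
  | _, _, _, .fluent _ _ u => u = .s0 ∨ u = α.sit
  | _, _, _, .poss _ _ => False
  | _, _, _, .prec _ _ => False
  | _, _, _, .imp φ ψ => φ.TwoSit α ∧ ψ.TwoSit α
  | _, _, _, .allObj φ => φ.TwoSit α
  | _, _, _, .allAct φ => φ.TwoSit α
  | _, _, _, .allSit _ => False

section TwoSit

variable {n a s : ℕ} (α : GroundAction L)

theorem Formula.twoSit_and {φ ψ : Formula L n a s} :
    (φ.and ψ).TwoSit α ↔ φ.TwoSit α ∧ ψ.TwoSit α := by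
  simp [Formula.and, Formula.neg, Formula.TwoSit]

theorem Formula.twoSit_or {φ ψ : Formula L n a s} :
    (φ.or ψ).TwoSit α ↔ φ.TwoSit α ∧ ψ.TwoSit α := by
  simp [Formula.or, Formula.neg, Formula.TwoSit]

theorem Formula.twoSit_neg {φ : Formula L n a s} : φ.neg.TwoSit α ↔ φ.TwoSit α := by
  simp [Formula.neg, Formula.TwoSit]

theorem Formula.twoSit_iff {φ ψ : Formula L n a s} :
    (φ.iff ψ).TwoSit α ↔ φ.TwoSit α ∧ ψ.TwoSit α := by
  simp only [Formula.iff, Formula.twoSit_and, Formula.TwoSit]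
  tauto

theorem Formula.twoSit_eqVec {k : ℕ} (t t' : Fin k → ObjTerm L n) :
    (Formula.eqVec t t' : Formula L n a s).TwoSit α := by
  have h : ∀ l : List (Formula L n a s), (∀ φ ∈ l, φ.TwoSit α) → (Formula.bigAnd l).TwoSit α := by
    intro l
    induction l with
    | nil => intro _; simp [Formula.bigAnd, Formula.verum, Formula.neg, Formula.TwoSit]
    | cons φ l ih =>
      intro hl
      exact (Formula.twoSit_and α).2
        ⟨hl φ (by simp), ih fun ψ hψ => hl ψ (List.mem_cons_of_mem _ hψ)⟩
  refine h _ fun φ hφ => ?_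
  obtain ⟨i, rfl⟩ := List.mem_ofFn.1 hφ
  trivial

theorem Formula.twoSit_atom (p : GroundAtom L) :
    (p.toFormula : Formula L n a s).TwoSit α := Or.inl rfl

theorem Formula.twoSit_of_uniform (φ : Formula L n a s) (h : φ.Uniform .s0) : φ.TwoSit α := by
  induction φ with
  | fluent F ts u => exact Or.inl h
  | imp φ ψ ih1 ih2 => exact ⟨ih1 h.1, ih2 h.2⟩
  | allObj φ ih => exact ih h
  | allAct φ ih => exact ih h
  | _ => exact h

theorem Formula.twoSit_bracket (p : GroundAtom L) (φ : Formula L n a s) (h : φ.TwoSit α) :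
    (φ.bracket p).TwoSit α := by
  induction φ with
  | fluent F ts u =>
    unfold Formula.bracket
    split
    · exact (Formula.twoSit_or α).2 ⟨(Formula.twoSit_and α).2
        ⟨Formula.twoSit_eqVec α _ _, Formula.twoSit_atom α p⟩, (Formula.twoSit_and α).2
        ⟨(Formula.twoSit_neg α).2 (Formula.twoSit_eqVec α _ _), h⟩⟩
    · exact h
  | imp φ ψ ih1 ih2 => exact ⟨ih1 h.1, ih2 h.2⟩
  | allObj φ ih => exact ih h
  | allAct φ ih => exact ih h
  | _ => exact h

theorem Formula.twoSit_setAtom (p : GroundAtom L) (b : Bool) (φ : Formula L n a s)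
    (h : φ.TwoSit α) : (φ.setAtom p b).TwoSit α := by
  induction φ with
  | fluent F ts u =>
    unfold Formula.setAtom
    split
    · split
      · simp [Formula.verum, Formula.neg, Formula.TwoSit]
      · trivial
    · exact h
  | imp φ ψ ih1 ih2 => exact ⟨ih1 h.1, ih2 h.2⟩
  | allObj φ ih => exact ih h
  | allAct φ ih => exact ih h
  | _ => exact h

theorem Theory.twoSit_forgetList (ω : List (GroundAtom L)) (T : Theory L)
    (h : ∀ φ ∈ T, Formula.TwoSit α φ) : ∀ φ ∈ T.forgetList ω, Formula.TwoSit α φ := by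
  induction ω generalizing T with
  | nil => exact h
  | cons p ω ih =>
    refine ih (T.forget p) ?_
    rintro _ ⟨φ, hφ, ψ, hψ, rfl⟩
    exact (Formula.twoSit_or α).2
      ⟨Formula.twoSit_setAtom α p _ _ (Formula.twoSit_bracket α p _ (h φ hφ)),
        Formula.twoSit_setAtom α p _ _ (Formula.twoSit_bracket α p _ (h ψ hψ))⟩

theorem Formula.twoSit_subst {n' a' s' : ℕ} (φ : Formula L n a s) (i : Fin s)
    (h : φ.Uniform (.var i)) (σ : Fin n → ObjTerm L n') (τ : Fin a → ActTerm L n' a')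
    (ρ : Fin s → SitTerm L n' a' s') (hρ : ρ i = .s0) : (φ.subst σ τ ρ).TwoSit α := by
  induction φ generalizing n' a' s' with
  | fluent F ts u =>
    simp only [Formula.Uniform] at h
    subst h
    exact Or.inl hρ
  | imp φ ψ ih1 ih2 => exact ⟨ih1 i h.1 σ τ ρ hρ, ih2 i h.2 σ τ ρ hρ⟩
  | allObj φ ih => exact ih i h _ _ _ (by rw [hρ]; rfl)
  | allAct φ ih => exact ih i h _ _ _ (by rw [hρ]; rfl)
  | _ => exact h

theorem Formula.uniform_exObjs (m : ℕ) (φ : Formula L (n + m) a s) (i : Fin s)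
    (h : φ.Uniform (.var i)) : (Formula.exObjs m φ).Uniform (.var i) := by
  induction m with
  | zero => exact h
  | succ m ih => exact ih _ ⟨⟨h, trivial⟩, trivial⟩

theorem Formula.uniform_bigAnd (l : List (Formula L n a s)) (S : SitTerm L n a s)
    (h : ∀ φ ∈ l, φ.Uniform S) : (Formula.bigAnd l).Uniform S := by
  induction l with
  | nil => exact ⟨trivial, trivial⟩
  | cons φ l ih =>
    exact ⟨⟨h φ (by simp), ih fun ψ hψ => h ψ (List.mem_cons_of_mem _ hψ), trivial⟩, trivial⟩

theorem Formula.uniform_bigOr (l : List (Formula L n a s)) (S : SitTerm L n a s)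
    (h : ∀ φ ∈ l, φ.Uniform S) : (Formula.bigOr l).Uniform S := by
  induction l with
  | nil => trivial
  | cons φ l ih =>
    exact ⟨⟨h φ (by simp), trivial⟩, ih fun ψ hψ => h ψ (List.mem_cons_of_mem _ hψ)⟩

theorem Effect.uniform_resolve (e : Effect L n) : (e.resolve α).Uniform (.var 0) := by
  unfold Effect.resolve
  split
  · refine Formula.uniform_exObjs _ _ _ ⟨⟨?_, e.ctx_uniform, trivial⟩, trivial⟩
    refine Formula.uniform_bigAnd _ _ fun φ hφ => ?_
    obtain ⟨i, rfl⟩ := List.mem_ofFn.1 hφ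
    trivial
  · trivial

theorem twoSit_gammaAt (l : List (Effect L n)) (t : Fin n → L.Const) :
    (gammaAt α l t).TwoSit α := by
  refine Formula.twoSit_subst α _ 0 (Formula.uniform_bigOr _ _ fun φ hφ => ?_) _ _ _ rfl
  obtain ⟨e, -, rfl⟩ := List.mem_map.1 hφ
  exact e.uniform_resolve α

theorem BAT.twoSit_instAt (D : BAT L) (p : GroundAtom L) : (D.instAt α p).TwoSit α :=
  (Formula.twoSit_iff α).2 ⟨Or.inr rfl, (Formula.twoSit_or α).2 ⟨twoSit_gammaAt α _ _,
    (Formula.twoSit_and α).2 ⟨Formula.twoSit_atom α p,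
      (Formula.twoSit_neg α).2 (twoSit_gammaAt α _ _)⟩⟩⟩

theorem Formula.uniform_replaceSit (φ : Formula L n a s) (h : φ.TwoSit α) :
    (φ.replaceSit .s0 α.sit).Uniform α.sit ∧
      ((φ.replaceSit .s0 α.sit).replaceSit α.sit .s0).Uniform .s0 := by
  induction φ with
  | fluent F ts u =>
    rcases h with rfl | rfl
    · simp [Formula.replaceSit, Formula.Uniform]
    · simp [Formula.replaceSit, Formula.Uniform, GroundAction.sit]
  | imp φ ψ ih1 ih2 =>
    exact ⟨⟨(ih1 h.1).1, (ih2 h.2).1⟩, (ih1 h.1).2, (ih2 h.2).2⟩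
  | allObj φ ih => exact ih h
  | allAct φ ih => exact ih h
  | _ => first | exact ⟨trivial, trivial⟩ | exact h.elim

theorem BAT.uniform_progression [Finite L.Fluent] (D : BAT L) :
    (∀ φ ∈ D.progression α, Formula.Uniform φ α.sit) ∧
      ∀ φ ∈ (D.progression α).replaceSit α.sit .s0, Formula.Uniform φ .s0 := by
  have h := Theory.twoSit_forgetList α (D.omegaList α) (D.inst α ∪ D.init) (by
    rintro φ (⟨p, -, rfl⟩ | hφ)
    · exact D.twoSit_instAt α p
    · exact Formula.twoSit_of_uniform α φ (D.init_uniform φ hφ))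
  refine ⟨?_, ?_⟩
  · rintro _ ⟨φ, hφ, rfl⟩
    exact (Formula.uniform_replaceSit α φ (h φ hφ)).1
  · rintro _ ⟨_, ⟨φ, hφ, rfl⟩, rfl⟩
    exact (Formula.uniform_replaceSit α φ (h φ hφ)).2

end TwoSit

/-- The basic action theory with initial theory `D_{S_α}(S₀/S_α)`. -/
noncomputable def BAT.progress [Finite L.Fluent] (D : BAT L) (α : GroundAction L) : BAT L where
  ssa := D.ssa
  init := (D.progression α).replaceSit α.sit .s0
  init_uniform := (D.uniform_progression α).2

/-! ### The conditions on a local-effect theory -/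

def FluentFree (Δ : Set (Symb L)) : Prop := ∀ F, Symb.fluent F ∉ Δ

/-- The conditions of the preservation theorem for local-effect theories: `DI` are the groups of
successor state axioms and `C` the components of the initial theory. -/
structure PreservationConditions (D : BAT L) (α : GroundAction L) (Δ₁ Δ₂ : Set (Symb L))
    {I J : Type*} (DI : I → Theory L) (C : J → Theory L) : Prop where
  localEffect : D.LocalEffect
  fluentFree₁ : FluentFree Δ₁
  fluentFree₂ : FluentFree Δ₂
  do_notMem₁ : Symb.doSym ∉ Δ₁
  do_notMem₂ : Symb.doSym ∉ Δ₂
  nonempty : Nonempty I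
  ss_eq : D.ssTheory = ⋃ i, DI i
  ss_inter : ∀ n m, n ≠ m → (DI n).sig ∩ (DI m).sig ⊆ Δ₁ ∪ {Symb.doSym}
  decomposition : IsDecomposition Δ₂ D.init C
  finite : ∀ j, (C j).Finite
  uniform : ∀ j, ∀ φ ∈ C j, Formula.Uniform φ .s0
  sig_diff : ∀ j, ((C j).sig \ (Δ₁ ∪ Δ₂ ∪ α.consts)).Nonempty
  fluents : ∀ F, Symb.fluent F ∈ D.ssTheory.sig → Symb.fluent F ∈ D.init.sig
  aligned : ∀ i, ∃ j, (DI i).sig ∩ D.init.sig ⊆ (C j).sig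

/-- The additional conditions for the strong preservation of components. -/
structure StrongPreservationConditions (D : BAT L) (α : GroundAction L) (Δ₁ Δ₂ : Set (Symb L))
    {I J : Type*} (DI : I → Theory L) (C : J → Theory L) : Prop
    extends PreservationConditions D α Δ₁ Δ₂ DI C where
  no_action : ∀ A, Symb.action A ∉ Δ₁
  consts_subset : ∀ j F, Symb.fluent F ∈ (C j).sig → (D.ssa F).Active α.act →
    α.consts ⊆ (C j).sig
  subset : Δ₁ ⊆ Δ₂

end SitCalc

open SitCalc

namespace SitCalc

variable {L : SitLang}

/-! ### Substitution and evaluation -/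

section Substitution

variable {n a s n' a' s' : ℕ}

/-! Only one component has to be progressed. Since `Δ₁` contains no action function, the action
symbol of `α` can be active in the axioms of at most one group `DI i`. By alignment, the symbols
that this group shares with the initial theory, in particular all fluents that `α` can change, lie
in a single component `C j`. The new decomposition replaces `C j` with its own progression and keeps
every other component.

Semantically, forgetting ground atoms is existential quantification over the truth values of the
facts they name. Hence `BAT.models_prog`: a structure satisfies the progression of `T` iff its facts
arise, by the instantiated axioms, from earlier facts that satisfy `T` and differ at most at the
facts named by `Ω(S₀)`. Facts before and after the action must vary independently, although a
structure may identify `S₀` with `do(α, S₀)`; so formulas are evaluated in the auxiliary structures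
`Str.twoSit`. Two consequences follow. The other components mention no affected fluent and cannot
tell the earlier facts from the later ones, so the earlier facts found for `C j` serve the whole
initial theory (`IsDecomposition.equiv_prog`). And each model of `T` has a successor, each model of
the progression a predecessor, differing only in fluents, so fluent-free consequences, and with them
inseparability, are unchanged (`BAT.entails_prog_iff`).

Syntactically, progression adds exactly the symbols of the instantiated axioms (`BAT.sig_prog`).
These belong to `C j` or to `DI i` and do not include `do`; those already in the initial theory lie
in `C j`, so no new overlap between components arises. A new symbol shared with another group would
lie in `Δ₁ ⊆ Δ₂`, hence in every component already. So the conditions persist for all ground actions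
at once, and induction along a sequence of actions goes through. -/

theorem ObjTerm.eval_subst (M : Str L) (σ : Fin n → ObjTerm L n') (vo : Fin n' → M.Obj)
    (t : ObjTerm L n) : (t.subst σ).eval M vo = t.eval M fun i => (σ i).eval M vo := by
  induction t with
  | var i => rfl
  | const c => rfl
  | func f ts ih => simp only [ObjTerm.subst, ObjTerm.eval, ih]

theorem ActTerm.eval_subst (M : Str L) (σ : Fin n → ObjTerm L n') (τ : Fin a → ActTerm L n' a')
    (vo : Fin n' → M.Obj) (va : Fin a' → M.Act) (t : ActTerm L n a) :
    (t.subst σ τ).eval M vo va =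
      t.eval M (fun i => (σ i).eval M vo) fun i => (τ i).eval M vo va := by
  cases t with
  | var i => rfl
  | app A ts => simp only [ActTerm.subst, ActTerm.eval, ObjTerm.eval_subst]

theorem SitTerm.eval_subst (M : Str L) (σ : Fin n → ObjTerm L n') (τ : Fin a → ActTerm L n' a')
    (ρ : Fin s → SitTerm L n' a' s') (vo : Fin n' → M.Obj) (va : Fin a' → M.Act)
    (vs : Fin s' → M.Sit) (u : SitTerm L n a s) :
    (u.subst σ τ ρ).eval M vo va vs =
      u.eval M (fun i => (σ i).eval M vo) (fun i => (τ i).eval M vo va)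
        fun i => (ρ i).eval M vo va vs := by
  induction u with
  | var i => rfl
  | s0 => rfl
  | doTerm t u ih => simp only [SitTerm.subst, SitTerm.eval, ActTerm.eval_subst, ih]

theorem ActTerm.eval_var (M : Str L) (vo : Fin n → M.Obj) (va : Fin a → M.Act) (i : Fin a) :
    (ActTerm.var i : ActTerm L n a).eval M vo va = va i := rfl

theorem ObjTerm.eval_wkObj (M : Str L) (vo : Fin n → M.Obj) (x : M.Obj) (t : ObjTerm L n) :
    t.wkObj.eval M (Fin.snoc (α := fun _ => M.Obj) vo x) = t.eval M vo := by
  simp [ObjTerm.wkObj, ObjTerm.eval_subst, ObjTerm.eval]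

theorem ActTerm.eval_wkObj (M : Str L) (vo : Fin n → M.Obj) (va : Fin a → M.Act) (x : M.Obj)
    (t : ActTerm L n a) :
    t.wkObj.eval M (Fin.snoc (α := fun _ => M.Obj) vo x) va = t.eval M vo va := by
  rw [ActTerm.wkObj, ActTerm.eval_subst]
  simp [ObjTerm.eval, ActTerm.eval_var]

theorem ActTerm.eval_wkAct (M : Str L) (vo : Fin n → M.Obj) (va : Fin a → M.Act) (x : M.Act)
    (t : ActTerm L n a) :
    t.wkAct.eval M vo (Fin.snoc (α := fun _ => M.Act) va x) = t.eval M vo va := by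
  rw [ActTerm.wkAct, ActTerm.eval_subst]
  simp [ObjTerm.eval, ActTerm.eval_var]

theorem SitTerm.eval_wkObj (M : Str L) (vo : Fin n → M.Obj) (va : Fin a → M.Act)
    (vs : Fin s → M.Sit) (x : M.Obj) (u : SitTerm L n a s) :
    u.wkObj.eval M (Fin.snoc (α := fun _ => M.Obj) vo x) va vs = u.eval M vo va vs := by
  simp [SitTerm.wkObj, SitTerm.eval_subst, ObjTerm.eval, ActTerm.eval_var, SitTerm.eval]

theorem SitTerm.eval_wkAct (M : Str L) (vo : Fin n → M.Obj) (va : Fin a → M.Act)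
    (vs : Fin s → M.Sit) (x : M.Act) (u : SitTerm L n a s) :
    u.wkAct.eval M vo (Fin.snoc (α := fun _ => M.Act) va x) vs = u.eval M vo va vs := by
  simp [SitTerm.wkAct, SitTerm.eval_subst, ObjTerm.eval, ActTerm.eval_var, SitTerm.eval]

theorem SitTerm.eval_wkSit (M : Str L) (vo : Fin n → M.Obj) (va : Fin a → M.Act)
    (vs : Fin s → M.Sit) (x : M.Sit) (u : SitTerm L n a s) :
    u.wkSit.eval M vo va (Fin.snoc (α := fun _ => M.Sit) vs x) = u.eval M vo va vs := by
  simp [SitTerm.wkSit, SitTerm.eval_subst, ObjTerm.eval, ActTerm.eval_var, SitTerm.eval]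

theorem Formula.holds_subst (M : Str L) (φ : Formula L n a s) (σ : Fin n → ObjTerm L n')
    (τ : Fin a → ActTerm L n' a') (ρ : Fin s → SitTerm L n' a' s') (vo : Fin n' → M.Obj)
    (va : Fin a' → M.Act) (vs : Fin s' → M.Sit) :
    (φ.subst σ τ ρ).Holds M vo va vs ↔
      φ.Holds M (fun i => (σ i).eval M vo) (fun i => (τ i).eval M vo va)
        fun i => (ρ i).eval M vo va vs := by
  induction φ generalizing n' a' s' with
  | allObj φ ih =>
    refine forall_congr' fun x => (ih _ _ _ _ _ _).trans (Iff.of_eq ?_)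
    simp only [ActTerm.eval_wkObj, SitTerm.eval_wkObj]
    congr 1
    funext i
    refine Fin.lastCases ?_ (fun i => ?_) i <;> simp [ObjTerm.eval_wkObj, ObjTerm.eval]
  | allAct φ ih =>
    refine forall_congr' fun x => (ih _ _ _ _ _ _).trans (Iff.of_eq ?_)
    simp only [SitTerm.eval_wkAct]
    congr 1
    funext i
    refine Fin.lastCases ?_ (fun i => ?_) i <;> simp [ActTerm.eval_wkAct, ActTerm.eval_var]
  | allSit φ ih =>
    refine forall_congr' fun x => (ih _ _ _ _ _ _).trans (Iff.of_eq ?_)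
    congr 1
    funext i
    refine Fin.lastCases ?_ (fun i => ?_) i <;> simp [SitTerm.eval_wkSit, SitTerm.eval]
  | imp φ ψ ih1 ih2 => exact imp_congr (ih1 _ _ _ _ _ _) (ih2 _ _ _ _ _ _)
  | _ => simp only [Formula.subst, Formula.Holds, ObjTerm.eval_subst, ActTerm.eval_subst,
      SitTerm.eval_subst]

end Substitution

/-! ### Connectives -/

section Connectives

variable {n a s : ℕ} (M : Str L) {vo : Fin n → M.Obj} {va : Fin a → M.Act} {vs : Fin s → M.Sit}

theorem Formula.holds_neg {φ : Formula L n a s} :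
    φ.neg.Holds M vo va vs ↔ ¬φ.Holds M vo va vs := Iff.rfl

theorem Formula.holds_verum : (verum : Formula L n a s).Holds M vo va vs := fun h => h

theorem Formula.holds_or {φ ψ : Formula L n a s} :
    (φ.or ψ).Holds M vo va vs ↔ φ.Holds M vo va vs ∨ ψ.Holds M vo va vs := by
  simp only [Formula.or, Formula.neg, Formula.Holds]
  tauto

theorem Formula.holds_and {φ ψ : Formula L n a s} :
    (φ.and ψ).Holds M vo va vs ↔ φ.Holds M vo va vs ∧ ψ.Holds M vo va vs := by
  simp only [Formula.and, Formula.neg, Formula.Holds]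
  tauto

theorem Formula.holds_iff {φ ψ : Formula L n a s} :
    (φ.iff ψ).Holds M vo va vs ↔ (φ.Holds M vo va vs ↔ ψ.Holds M vo va vs) := by
  simp only [Formula.iff, Formula.holds_and, Formula.Holds]
  tauto

theorem Formula.holds_bigAnd {l : List (Formula L n a s)} :
    (bigAnd l).Holds M vo va vs ↔ ∀ φ ∈ l, φ.Holds M vo va vs := by
  induction l with
  | nil => simp [bigAnd, holds_verum]
  | cons φ l ih => simpa [bigAnd, holds_and] using fun _ => ih

theorem Formula.holds_eqVec {k : ℕ} {t t' : Fin k → ObjTerm L n} :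
    (eqVec t t' : Formula L n a s).Holds M vo va vs ↔
      ∀ i, (t i).eval M vo = (t' i).eval M vo := by
  simp [eqVec, holds_bigAnd, List.mem_ofFn, Formula.Holds]

end Connectives

/-! ### Structures with prescribed fluents -/

/-- The ground facts over the domain of `M`. -/
abbrev Str.Fact (M : Str L) : Type := (F : L.Fluent) × (Fin (L.fluentArity F) → M.Obj)

/-- The facts that hold in the initial situation of `M`. -/
def Str.facts (M : Str L) : Set M.Fact := {y | M.fluent y.1 y.2 M.s0}

/-- The fact named by a ground atom. -/
def GroundAtom.fact (p : GroundAtom L) (M : Str L) : M.Fact := ⟨p.1, fun i => M.const (p.2 i)⟩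

/-- `M` with its fluents replaced by those that hold, in every situation, exactly of `R`. -/
abbrev Str.withFacts (M : Str L) (R : Set M.Fact) : Str L :=
  { M with fluent := fun F x _ => ⟨F, x⟩ ∈ R }

/-- The structure over the objects and actions of `M` with the two situations `S₀` and
`do(·, S₀)`, in which the facts are `R₀` and `R₁`. -/
abbrev Str.twoSit (M : Str L) (R₀ R₁ : Set M.Fact) : Str L where
  Obj := M.Obj
  Act := M.Act
  Sit := Bool
  obj_nonempty := M.obj_nonempty
  act_nonempty := M.act_nonempty
  const := M.const
  func := M.func
  pred := M.pred
  action := M.action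
  s0 := false
  doFun _ _ := true
  prec _ _ := True
  poss _ _ := True
  fluent F x b := ⟨F, x⟩ ∈ cond b R₁ R₀

section Eval

variable {n a s : ℕ} (M : Str L)

theorem ObjTerm.eval_withFacts (R : Set M.Fact) (vo : Fin n → M.Obj) (t : ObjTerm L n) :
    t.eval (M.withFacts R) vo = t.eval M vo := by
  induction t with
  | func f ts ih => exact congrArg (M.func f) (funext ih)
  | _ => rfl

theorem ActTerm.eval_withFacts (R : Set M.Fact) (vo : Fin n → M.Obj) (va : Fin a → M.Act)
    (t : ActTerm L n a) : t.eval (M.withFacts R) vo va = t.eval M vo va := by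
  cases t with
  | var i => rfl
  | app A ts => exact congrArg (M.action A) (funext fun i => ObjTerm.eval_withFacts M R vo (ts i))

theorem SitTerm.eval_withFacts (R : Set M.Fact) (vo : Fin n → M.Obj) (va : Fin a → M.Act)
    (vs : Fin s → M.Sit) (u : SitTerm L n a s) :
    u.eval (M.withFacts R) vo va vs = u.eval M vo va vs := by
  induction u with
  | doTerm t u ih => exact congrArg₂ M.doFun (ActTerm.eval_withFacts M R vo va t) ih
  | _ => rfl

theorem ObjTerm.eval_twoSit (R₀ R₁ : Set M.Fact) (vo : Fin n → M.Obj) (t : ObjTerm L n) :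
    t.eval (M.twoSit R₀ R₁) vo = t.eval M vo := by
  induction t with
  | func f ts ih => exact congrArg (M.func f) (funext ih)
  | _ => rfl

theorem ActTerm.eval_twoSit (R₀ R₁ : Set M.Fact) (vo : Fin n → M.Obj) (va : Fin a → M.Act)
    (t : ActTerm L n a) : t.eval (M.twoSit R₀ R₁) vo va = t.eval M vo va := by
  cases t with
  | var i => rfl
  | app A ts => exact congrArg (M.action A) (funext fun i => ObjTerm.eval_twoSit M R₀ R₁ vo (ts i))

theorem Formula.holds_withFacts (R : Set M.Fact) (φ : Formula L n a s)
    (h : ∀ F, Symb.fluent F ∉ φ.sig) (vo : Fin n → M.Obj) (va : Fin a → M.Act)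
    (vs : Fin s → M.Sit) : φ.Holds (M.withFacts R) vo va vs ↔ φ.Holds M vo va vs := by
  induction φ with
  | falsum => exact Iff.rfl
  | eqObj t t' =>
    exact Iff.of_eq (congrArg₂ (· = ·) (ObjTerm.eval_withFacts M R vo t)
      (ObjTerm.eval_withFacts M R vo t'))
  | eqAct t t' =>
    exact Iff.of_eq (congrArg₂ (· = ·) (ActTerm.eval_withFacts M R vo va t)
      (ActTerm.eval_withFacts M R vo va t'))
  | eqSit t t' =>
    exact Iff.of_eq (congrArg₂ (· = ·) (SitTerm.eval_withFacts M R vo va vs t)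
      (SitTerm.eval_withFacts M R vo va vs t'))
  | pred P ts =>
    exact Iff.of_eq (congrArg (M.pred P) (funext fun i => ObjTerm.eval_withFacts M R vo (ts i)))
  | fluent F ts u => exact (h F (by simp [Formula.sig])).elim
  | poss t u =>
    exact Iff.of_eq (congrArg₂ M.poss (ActTerm.eval_withFacts M R vo va t)
      (SitTerm.eval_withFacts M R vo va vs u))
  | prec t t' =>
    exact Iff.of_eq (congrArg₂ M.prec (SitTerm.eval_withFacts M R vo va vs t)
      (SitTerm.eval_withFacts M R vo va vs t'))
  | imp φ ψ ih1 ih2 =>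
    exact imp_congr (ih1 (fun F hF => h F (Or.inl hF)) vo va vs)
      (ih2 (fun F hF => h F (Or.inr hF)) vo va vs)
  | allObj φ ih => exact forall_congr' fun x => ih h _ va vs
  | allAct φ ih => exact forall_congr' fun x => ih h vo _ vs
  | allSit φ ih => exact forall_congr' fun x => ih h vo va _

/-- In a structure with two situations, a formula uniform in `S₀` depends only on the facts at
`S₀` about the fluents that occur in it. -/
theorem Formula.holds_twoSit_congr {R₀ R₁ R₀' R₁' : Set M.Fact} (φ : Formula L n a s)
    (hφ : φ.Uniform .s0) (h : ∀ y : M.Fact, Symb.fluent y.1 ∈ φ.sig → (y ∈ R₀ ↔ y ∈ R₀'))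
    (vo : Fin n → M.Obj) (va : Fin a → M.Act) (vs : Fin s → Bool) :
    φ.Holds (M.twoSit R₀ R₁) vo va vs ↔ φ.Holds (M.twoSit R₀' R₁') vo va vs := by
  have ho : ∀ t : ObjTerm L n, t.eval (M.twoSit R₀ R₁) vo = t.eval (M.twoSit R₀' R₁') vo :=
    fun t => (t.eval_twoSit M _ _ vo).trans (t.eval_twoSit M _ _ vo).symm
  have ha : ∀ t : ActTerm L n a,
      t.eval (M.twoSit R₀ R₁) vo va = t.eval (M.twoSit R₀' R₁') vo va :=
    fun t => (t.eval_twoSit M _ _ vo va).trans (t.eval_twoSit M _ _ vo va).symm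
  induction φ with
  | falsum => exact Iff.rfl
  | eqObj t t' => exact Iff.of_eq (congrArg₂ (· = ·) (ho t) (ho t'))
  | eqAct t t' => exact Iff.of_eq (congrArg₂ (· = ·) (ha t) (ha t'))
  | pred P ts => exact Iff.of_eq (congrArg (M.pred P) (funext fun i => ho (ts i)))
  | fluent F ts u =>
    cases hφ
    refine Iff.trans (h ⟨F, _⟩ (by simp [Formula.sig])) (Iff.of_eq ?_)
    exact congrArg (fun x => (⟨F, x⟩ : M.Fact) ∈ R₀') (funext fun i => ho (ts i))
  | imp φ ψ ih1 ih2 =>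
    exact imp_congr (ih1 hφ.1 (fun y hy => h y (Or.inl hy)) vo va vs ho ha)
      (ih2 hφ.2 (fun y hy => h y (Or.inr hy)) vo va vs ho ha)
  | allObj φ ih =>
    exact forall_congr' fun x => ih hφ h _ va vs
      (fun t => (t.eval_twoSit M _ _ _).trans (t.eval_twoSit M _ _ _).symm)
      (fun t => (t.eval_twoSit M _ _ _ _).trans (t.eval_twoSit M _ _ _ _).symm)
  | allAct φ ih =>
    exact forall_congr' fun x => ih hφ h vo _ vs ho
      (fun t => (t.eval_twoSit M _ _ _ _).trans (t.eval_twoSit M _ _ _ _).symm)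
  | _ => exact hφ.elim

end Eval

/-! ### Moving all fluents to the initial situation -/

/-- Every situation argument of a fluent is replaced with `S₀`. -/
def Formula.atS0 : {n a s : ℕ} → Formula L n a s → Formula L n a s
  | _, _, _, .falsum => .falsum
  | _, _, _, .eqObj t t' => .eqObj t t'
  | _, _, _, .eqAct t t' => .eqAct t t'
  | _, _, _, .eqSit u u' => .eqSit u u'
  | _, _, _, .pred P ts => .pred P ts
  | _, _, _, .fluent F ts _ => .fluent F ts .s0
  | _, _, _, .poss t u => .poss t u
  | _, _, _, .prec u u' => .prec u u'
  | _, _, _, .imp φ ψ => .imp φ.atS0 ψ.atS0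
  | _, _, _, .allObj φ => .allObj φ.atS0
  | _, _, _, .allAct φ => .allAct φ.atS0
  | _, _, _, .allSit φ => .allSit φ.atS0

section AtS0

variable {n a s : ℕ} (α : GroundAction L)

/-- The first replacement moves atoms at `S₀` to `S_α`, joining those already there; the second
brings all of them back. Only whole situation arguments are replaced, so the `S₀` inside `S_α` is
untouched. -/
theorem Formula.replaceSit_replaceSit (φ : Formula L n a s) (h : φ.TwoSit α) :
    (φ.replaceSit .s0 α.sit).replaceSit α.sit .s0 = φ.atS0 := by
  induction φ with
  | fluent F ts u =>
    rcases h with rfl | rfl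
    · simp [Formula.replaceSit, Formula.atS0]
    · simp [Formula.replaceSit, Formula.atS0, GroundAction.sit]
  | imp φ ψ ih1 ih2 => exact congrArg₂ Formula.imp (ih1 h.1) (ih2 h.2)
  | allObj φ ih => exact congrArg Formula.allObj (ih h)
  | allAct φ ih => exact congrArg Formula.allAct (ih h)
  | _ => first | rfl | exact h.elim

theorem Formula.atS0_of_uniform (φ : Formula L n a s) (h : φ.Uniform .s0) : φ.atS0 = φ := by
  induction φ with
  | fluent F ts u =>
    cases h
    rfl
  | imp φ ψ ih1 ih2 => exact congrArg₂ Formula.imp (ih1 h.1) (ih2 h.2)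
  | allObj φ ih => exact congrArg Formula.allObj (ih h)
  | allAct φ ih => exact congrArg Formula.allAct (ih h)
  | allSit φ ih => exact h.elim
  | _ => rfl

/-- Identifying the two situations syntactically amounts to giving both the same facts. The
assignment `vs'` is arbitrary because the situation arguments are `S₀` or `S_α`, never variables. -/
theorem Formula.holds_atS0 (M : Str L) (φ : Formula L n a s) (h : φ.TwoSit α)
    (vo : Fin n → M.Obj) (va : Fin a → M.Act) (vs : Fin s → M.Sit) (vs' : Fin s → Bool) :
    φ.atS0.Holds M vo va vs ↔ φ.Holds (M.twoSit M.facts M.facts) vo va vs' := by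
  induction φ with
  | falsum => exact Iff.rfl
  | eqObj t t' =>
    exact Iff.of_eq (congrArg₂ (· = ·) (t.eval_twoSit M _ _ vo) (t'.eval_twoSit M _ _ vo)).symm
  | eqAct t t' =>
    exact Iff.of_eq
      (congrArg₂ (· = ·) (t.eval_twoSit M _ _ vo va) (t'.eval_twoSit M _ _ vo va)).symm
  | pred P ts =>
    exact Iff.of_eq (congrArg (M.pred P) (funext fun i => ((ts i).eval_twoSit M _ _ vo).symm))
  | fluent F ts u =>
    have h1 : ∀ b, cond b M.facts M.facts = M.facts := by rintro (_ | _) <;> rfl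
    refine Iff.trans (Iff.of_eq ?_)
      (Iff.of_eq (congrArg (fun R => (⟨F, _⟩ : M.Fact) ∈ R) (h1 _))).symm
    exact congrArg (fun x => M.fluent F x M.s0)
      (funext fun i => ((ts i).eval_twoSit M _ _ vo).symm)
  | imp φ ψ ih1 ih2 => exact imp_congr (ih1 h.1 vo va vs vs') (ih2 h.2 vo va vs vs')
  | allObj φ ih => exact forall_congr' fun x => ih h _ va vs vs'
  | allAct φ ih => exact forall_congr' fun x => ih h vo _ vs vs'
  | _ => exact h.elim

end AtS0

/-! ### Semantics of forgetting -/

/-- The facts `R` with the truth value of `y` changed to `b`. -/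
def Str.setFact (M : Str L) (R : Set M.Fact) (y : M.Fact) (b : Bool) : Set M.Fact :=
  {z | (z = y ∧ b = true) ∨ (z ≠ y ∧ z ∈ R)}

section Forget

variable {n a s : ℕ}

theorem Formula.setAtom_eqVec {k : ℕ} (t t' : Fin k → ObjTerm L n) (p : GroundAtom L) (b : Bool) :
    (eqVec t t' : Formula L n a s).setAtom p b = eqVec t t' := by
  have h : ∀ l : List (Formula L n a s), (∀ φ ∈ l, φ.setAtom p b = φ) →
      (bigAnd l).setAtom p b = bigAnd l := by
    intro l
    induction l with
    | nil => intro _; rfl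
    | cons φ l ih =>
      intro hl
      have h1 := hl φ (by simp)
      have h2 := ih fun ψ hψ => hl ψ (List.mem_cons_of_mem _ hψ)
      simp only [bigAnd, List.foldr] at h2 ⊢
      simp only [Formula.and, Formula.neg, Formula.setAtom, h1, h2]
  refine h _ fun φ hφ => ?_
  obtain ⟨i, rfl⟩ := List.mem_ofFn.1 hφ
  rfl

/-- The truth value `b` as a formula. -/
def Formula.ofBool (b : Bool) : Formula L n a s := if b = true then .verum else .falsum

theorem Formula.holds_ofBool (M : Str L) (b : Bool) (vo : Fin n → M.Obj) (va : Fin a → M.Act)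
    (vs : Fin s → M.Sit) : (ofBool b : Formula L n a s).Holds M vo va vs ↔ b = true := by
  cases b
  · simp [ofBool, Formula.Holds]
  · simp [ofBool, holds_verum]

-- The conditional covers the case that the atom is literally the forgotten one: then its copy in
-- the second disjunct is overwritten as well.
open Classical in
theorem Formula.setAtom_bracket_fluent (F : L.Fluent) (t : Fin (L.fluentArity F) → L.Const)
    (b : Bool) (ts : Fin (L.fluentArity F) → ObjTerm L n) :
    ((Formula.fluent F ts .s0 : Formula L n a s).bracket ⟨F, t⟩).setAtom ⟨F, t⟩ b =
      .or (.and (eqVec (fun i => .const (t i)) ts) (ofBool b))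
        (.and (.neg (eqVec (fun i => .const (t i)) ts))
          (if ts = fun i => .const (t i) then ofBool b else .fluent F ts .s0)) := by
  simp only [Formula.bracket, and_self, dif_pos]
  simp only [Formula.or, Formula.and, Formula.neg, Formula.setAtom, Formula.setAtom_eqVec,
    Fin.cast_refl, id, GroundAtom.toFormula, Formula.fluent.injEq, heq_eq_eq, true_and, and_true,
    if_true, ofBool]

theorem Formula.setAtom_bracket_of_ne (p : GroundAtom L) (b : Bool) (F : L.Fluent)
    (ts : Fin (L.fluentArity F) → ObjTerm L n) (u : SitTerm L n a s)
    (h : ¬(F = p.1 ∧ u = .s0)) :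
    ((Formula.fluent F ts u).bracket p).setAtom p b = .fluent F ts u := by
  simp only [Formula.bracket, dif_neg h]
  rw [Formula.setAtom, if_neg]
  intro h'
  simp only [GroundAtom.toFormula, Formula.fluent.injEq] at h'
  exact h ⟨h'.1, h'.2.2⟩

/-- The syntactic operation behind forgetting is a change of one fact at `S₀`. The case distinction
on `t̄ = t̄'` catches atoms whose arguments differ from the constants of `p` as terms but denote the
same objects. Atoms at `S_α` read `R₁` and are not affected. -/
theorem Formula.holds_setAtom_bracket (α : GroundAction L) (p : GroundAtom L) (b : Bool)
    (M : Str L) (R₀ R₁ : Set M.Fact) (φ : Formula L n a s) (h : φ.TwoSit α) (vo : Fin n → M.Obj)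
    (va : Fin a → M.Act) (vs : Fin s → Bool) :
    ((φ.bracket p).setAtom p b).Holds (M.twoSit R₀ R₁) vo va vs ↔
      φ.Holds (M.twoSit (M.setFact R₀ (p.fact M) b) R₁) vo va vs := by
  have ho : ∀ t : ObjTerm L n, t.eval (M.twoSit R₀ R₁) vo =
      t.eval (M.twoSit (M.setFact R₀ (p.fact M) b) R₁) vo :=
    fun t => (t.eval_twoSit M _ _ vo).trans (t.eval_twoSit M _ _ vo).symm
  have ha : ∀ t : ActTerm L n a, t.eval (M.twoSit R₀ R₁) vo va =
      t.eval (M.twoSit (M.setFact R₀ (p.fact M) b) R₁) vo va :=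
    fun t => (t.eval_twoSit M _ _ vo va).trans (t.eval_twoSit M _ _ vo va).symm
  induction φ with
  | falsum => exact Iff.rfl
  | eqObj t t' => exact Iff.of_eq (congrArg₂ (· = ·) (ho t) (ho t'))
  | eqAct t t' => exact Iff.of_eq (congrArg₂ (· = ·) (ha t) (ha t'))
  | pred P ts => exact Iff.of_eq (congrArg (M.pred P) (funext fun i => ho (ts i)))
  | fluent F ts u =>
    have hx : ∀ R₀ R₁ : Set M.Fact, (fun i => (ts i).eval (M.twoSit R₀ R₁) vo) =
      fun i => (ts i).eval M vo := fun R₀ R₁ => funext fun i => (ts i).eval_twoSit M _ _ vo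
    by_cases hp : F = p.1 ∧ u = .s0
    · obtain ⟨G, t⟩ := p
      obtain ⟨rfl, rfl⟩ := hp
      rw [Formula.setAtom_bracket_fluent, Formula.holds_or, Formula.holds_and, Formula.holds_and,
        Formula.holds_neg, Formula.holds_eqVec, Formula.holds_ofBool]
      have he : (∀ i, (ObjTerm.const (t i)).eval (M.twoSit R₀ R₁) vo =
          (ts i).eval (M.twoSit R₀ R₁) vo) ↔
          (⟨F, fun i => (ts i).eval M vo⟩ : M.Fact) = GroundAtom.fact ⟨F, t⟩ M := by
        simp only [GroundAtom.fact, Sigma.mk.injEq, heq_eq_eq, true_and, funext_iff,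
          ObjTerm.eval_twoSit]
        exact forall_congr' fun i => eq_comm
      have hr : (Formula.fluent F ts .s0 : Formula L _ _ _).Holds
          (M.twoSit (M.setFact R₀ (GroundAtom.fact ⟨F, t⟩ M) b) R₁) vo va vs ↔
          (⟨F, fun i => (ts i).eval M vo⟩ : M.Fact) ∈
            M.setFact R₀ (GroundAtom.fact ⟨F, t⟩ M) b :=
        Iff.of_eq (congrArg (fun x => (⟨F, x⟩ : M.Fact) ∈
          M.setFact R₀ (GroundAtom.fact ⟨F, t⟩ M) b) (hx _ _))
      rw [hr, he]
      refine or_congr Iff.rfl (and_congr_right fun hne => ?_)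
      -- If the arguments were literally the constants of the forgotten atom, the guard `hne` of
      -- this disjunct would fail.
      rw [if_neg]
      · exact Iff.of_eq (congrArg (fun x => (⟨F, x⟩ : M.Fact) ∈ R₀) (hx _ _))
      · rintro rfl
        exact hne rfl
    · rw [Formula.setAtom_bracket_of_ne p b F ts u hp]
      rcases h with rfl | rfl
      · have hF : F ≠ p.1 := fun h => hp ⟨h, rfl⟩
        have hne : ∀ x, (⟨F, x⟩ : M.Fact) ≠ p.fact M := fun x h => hF (congrArg Sigma.fst h)
        have h1 : ∀ x, (⟨F, x⟩ : M.Fact) ∈ M.setFact R₀ (p.fact M) b ↔ ⟨F, x⟩ ∈ R₀ := by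
          intro x
          simp [Str.setFact, hne x]
        refine Iff.trans (Iff.of_eq ?_) (h1 _).symm
        exact congrArg (fun x => (⟨F, x⟩ : M.Fact) ∈ R₀) ((hx _ _).trans (hx _ _).symm)
      · exact Iff.of_eq (congrArg (fun x => (⟨F, x⟩ : M.Fact) ∈ R₁) ((hx _ _).trans (hx _ _).symm))
  | imp φ ψ ih1 ih2 => exact imp_congr (ih1 h.1 vo va vs ho ha) (ih2 h.2 vo va vs ho ha)
  | allObj φ ih =>
    exact forall_congr' fun x => ih h _ va vs
      (fun t => (t.eval_twoSit M _ _ _).trans (t.eval_twoSit M _ _ _).symm)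
      (fun t => (t.eval_twoSit M _ _ _ _).trans (t.eval_twoSit M _ _ _ _).symm)
  | allAct φ ih =>
    exact forall_congr' fun x => ih h vo _ vs ho
      (fun t => (t.eval_twoSit M _ _ _ _).trans (t.eval_twoSit M _ _ _ _).symm)
  | _ => exact h.elim

theorem Theory.twoSit_forget (α : GroundAction L) (p : GroundAtom L) (T : Theory L)
    (hT : ∀ φ ∈ T, Formula.TwoSit α φ) : ∀ φ ∈ T.forget p, Formula.TwoSit α φ :=
  Theory.twoSit_forgetList α [p] T hT

/-- Forgetting quantifies existentially over one truth value. The distributed form `φ⁺ ∨ ψ⁻`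
suffices even for infinite theories. -/
theorem Theory.models_forget (α : GroundAction L) (p : GroundAtom L) (T : Theory L)
    (hT : ∀ φ ∈ T, Formula.TwoSit α φ) (M : Str L) (R₀ R₁ : Set M.Fact) :
    (M.twoSit R₀ R₁).Models (T.forget p) ↔
      ∃ b, (M.twoSit (M.setFact R₀ (p.fact M) b) R₁).Models T := by
  constructor
  · intro h
    -- If both truth values fail, one sentence `φ` refutes true and one sentence `ψ` refutes false,
    -- so the member `φ⁺ ∨ ψ⁻` of the forgotten theory fails.
    by_contra! hc
    obtain ⟨φ, hφ, h1⟩ := not_forall₂.1 (hc true)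
    obtain ⟨ψ, hψ, h2⟩ := not_forall₂.1 (hc false)
    rcases (Formula.holds_or _).1 (h _ ⟨φ, hφ, ψ, hψ, rfl⟩) with h' | h'
    · exact h1 ((Formula.holds_setAtom_bracket α p true M R₀ R₁ φ (hT φ hφ) _ _ _).1 h')
    · exact h2 ((Formula.holds_setAtom_bracket α p false M R₀ R₁ ψ (hT ψ hψ) _ _ _).1 h')
  · rintro ⟨b, h⟩ _ ⟨φ, hφ, ψ, hψ, rfl⟩
    refine (Formula.holds_or _).2 ?_
    cases b
    · exact Or.inr ((Formula.holds_setAtom_bracket α p false M R₀ R₁ ψ (hT ψ hψ) _ _ _).2 (h ψ hψ))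
    · exact Or.inl ((Formula.holds_setAtom_bracket α p true M R₀ R₁ φ (hT φ hφ) _ _ _).2 (h φ hφ))

/-- Iterated forgetting quantifies over all named truth values jointly. The condition refers to
facts rather than atoms, since several atoms may name the same fact. -/
theorem Theory.models_forgetList (α : GroundAction L) (ω : List (GroundAtom L)) (T : Theory L)
    (hT : ∀ φ ∈ T, Formula.TwoSit α φ) (M : Str L) (R₀ R₁ : Set M.Fact) :
    (M.twoSit R₀ R₁).Models (T.forgetList ω) ↔
      ∃ R : Set M.Fact, (∀ y, (∀ p ∈ ω, y ≠ p.fact M) → (y ∈ R ↔ y ∈ R₀)) ∧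
        (M.twoSit R R₁).Models T := by
  induction ω generalizing T with
  | nil =>
    constructor
    · exact fun h => ⟨R₀, fun _ _ => Iff.rfl, h⟩
    · rintro ⟨R, hR, h⟩
      obtain rfl : R = R₀ := Set.ext fun y => hR y (by simp)
      exact h
  | cons p ω ih =>
    refine (ih (T.forget p) (Theory.twoSit_forget α p T hT)).trans ?_
    simp only [Theory.models_forget α p T hT]
    constructor
    · rintro ⟨R, hR, b, h⟩
      refine ⟨_, fun y hy => ?_, h⟩
      rw [← hR y fun q hq => hy q (List.mem_cons_of_mem _ hq)]
      simp [Str.setFact, hy p (by simp)]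
    · rintro ⟨R, hR, h⟩
      classical
      -- The intermediate set keeps the value of `R₀` at the fact of `p`, which the remaining atoms
      -- need not name, and follows `R` elsewhere; the truth value chosen for `p` then restores `R`.
      refine ⟨{y | (y = p.fact M ∧ y ∈ R₀) ∨ (y ≠ p.fact M ∧ y ∈ R)}, fun y hy => ?_,
        decide (p.fact M ∈ R), ?_⟩
      · by_cases hp : y = p.fact M
        · simp [hp]
        · have := hR y fun q hq => by
            rcases List.mem_cons.1 hq with rfl | hq
            · exact hp
            · exact hy q hq
          simp [hp, this]
      · convert h using 2
        ext y
        by_cases hp : y = p.fact M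
        · simp [Str.setFact, hp]
        · simp [Str.setFact, hp]

end Forget

/-! ### Semantics of progression -/

/-- The progression of the theory `T` with respect to `α`, stated at `S₀`. -/
noncomputable def BAT.prog [Finite L.Fluent] (D : BAT L) (α : GroundAction L) (T : Theory L) :
    Theory L :=
  ((Theory.forgetList (D.inst α ∪ T) (D.omegaList α)).replaceSit .s0 α.sit).replaceSit α.sit .s0

/-- The right-hand side `γ⁺(t̄, α, S₀) ∨ F(t̄, S₀) ∧ ¬ γ⁻(t̄, α, S₀)` of an instantiated axiom. -/
noncomputable def BAT.effectAt (D : BAT L) (α : GroundAction L) (p : GroundAtom L) : Sentence L :=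
  .or (gammaAt α (D.ssa p.1).pos p.2) (.and p.toFormula (.neg (gammaAt α (D.ssa p.1).neg p.2)))

section Progression

theorem Formula.uniform_subst {n a s n' a' s' : ℕ} (φ : Formula L n a s) (i : Fin s)
    (h : φ.Uniform (.var i)) (σ : Fin n → ObjTerm L n') (τ : Fin a → ActTerm L n' a')
    (ρ : Fin s → SitTerm L n' a' s') (hρ : ρ i = .s0) : (φ.subst σ τ ρ).Uniform .s0 := by
  induction φ generalizing n' a' s' with
  | fluent F ts u =>
    cases h
    exact hρ
  | imp φ ψ ih1 ih2 => exact ⟨ih1 i h.1 σ τ ρ hρ, ih2 i h.2 σ τ ρ hρ⟩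
  | allObj φ ih => exact ih i h _ _ _ (by rw [hρ]; rfl)
  | allAct φ ih => exact ih i h _ _ _ (by rw [hρ]; rfl)
  | _ => exact h

variable (D : BAT L) (α : GroundAction L)

theorem uniform_gammaAt {n : ℕ} (l : List (Effect L n)) (t : Fin n → L.Const) :
    (gammaAt α l t).Uniform .s0 := by
  refine Formula.uniform_subst _ 0 (Formula.uniform_bigOr _ _ fun φ hφ => ?_) _ _ _ rfl
  obtain ⟨e, -, rfl⟩ := List.mem_map.1 hφ
  exact e.uniform_resolve α

theorem BAT.uniform_effectAt (p : GroundAtom L) : (D.effectAt α p).Uniform .s0 :=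
  ⟨⟨uniform_gammaAt α _ _, trivial⟩, ⟨rfl, ⟨uniform_gammaAt α _ _, trivial⟩, trivial⟩, trivial⟩

theorem holds_gammaAt_congr {n : ℕ} (M : Str L) (l : List (Effect L n)) {t t' : Fin n → L.Const}
    (h : (fun i => M.const (t i)) = fun i => M.const (t' i)) {vo va vs} :
    (gammaAt α l t).Holds M vo va vs ↔ (gammaAt α l t').Holds M vo va vs := by
  simp only [gammaAt, Formula.holds_subst, ObjTerm.eval, h]

/-- Different constants may denote the same object. Two ground atoms naming one fact must prescribe
the same successor value, or the facts after the action would be ill-defined. -/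
theorem BAT.holds_effectAt_congr (M : Str L) (R₀ R₁ : Set M.Fact) {p q : GroundAtom L}
    (h : p.fact M = q.fact M) {vo va vs} :
    (D.effectAt α p).Holds (M.twoSit R₀ R₁) vo va vs ↔
      (D.effectAt α q).Holds (M.twoSit R₀ R₁) vo va vs := by
  obtain ⟨F, t⟩ := p
  obtain ⟨G, t'⟩ := q
  obtain rfl : F = G := congrArg Sigma.fst h
  have h' : (fun i => M.const (t i)) = fun i => M.const (t' i) := by
    simpa [GroundAtom.fact] using h
  have h1 : ∀ l : List (Effect L (L.fluentArity F)), _ :=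
    fun l => holds_gammaAt_congr α (M.twoSit R₀ R₁) l h' (vo := vo) (va := va) (vs := vs)
  have h2 : (GroundAtom.toFormula ⟨F, t⟩ : Sentence L).Holds (M.twoSit R₀ R₁) vo va vs ↔
      (GroundAtom.toFormula ⟨F, t'⟩ : Sentence L).Holds (M.twoSit R₀ R₁) vo va vs :=
    Iff.of_eq (congrArg (fun x => (⟨F, x⟩ : M.Fact) ∈ R₀) h')
  simp only [BAT.effectAt, Formula.holds_or, Formula.holds_and, Formula.holds_neg, h1, h2]

theorem BAT.holds_instAt (M : Str L) (R₀ R₁ : Set M.Fact) (p : GroundAtom L) {vo va vs} :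
    (D.instAt α p).Holds (M.twoSit R₀ R₁) vo va vs ↔
      (p.fact M ∈ R₁ ↔ (D.effectAt α p).Holds (M.twoSit R₀ R₁) vo va vs) :=
  Formula.holds_iff _

theorem BAT.twoSit_inst_union {T : Theory L} (hT : ∀ φ ∈ T, Formula.Uniform φ .s0) :
    ∀ φ ∈ D.inst α ∪ T, Formula.TwoSit α φ := by
  rintro φ (⟨p, -, rfl⟩ | hφ)
  · exact D.twoSit_instAt α p
  · exact Formula.twoSit_of_uniform α φ (hT φ hφ)

/-- A theory uniform in `S₀` sees nothing of a structure's situations except the facts at `S₀`, so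
the facts `R₁` at the other situation are free. -/
theorem Theory.models_iff_twoSit {T : Theory L} (hT : ∀ φ ∈ T, Formula.Uniform φ .s0)
    (α : GroundAction L) (M : Str L) (R₁ : Set M.Fact) :
    M.Models T ↔ (M.twoSit M.facts R₁).Models T := by
  refine forall₂_congr fun φ hφ => ?_
  have h1 := Formula.holds_atS0 α M φ (Formula.twoSit_of_uniform α φ (hT φ hφ)) Fin.elim0 Fin.elim0
    Fin.elim0 Fin.elim0
  rw [Formula.atS0_of_uniform φ (hT φ hφ)] at h1
  exact h1.trans
    (Formula.holds_twoSit_congr M φ (hT φ hφ) (fun _ _ => Iff.rfl) Fin.elim0 Fin.elim0 Fin.elim0)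

variable [Finite L.Fluent]

theorem BAT.mem_omegaList {p : GroundAtom L} : p ∈ D.omegaList α ↔ p ∈ D.omega α := by
  simp [BAT.omegaList]

theorem BAT.prog_eq {T : Theory L} (hT : ∀ φ ∈ T, Formula.Uniform φ .s0) :
    D.prog α T = Formula.atS0 '' Theory.forgetList (D.inst α ∪ T) (D.omegaList α) := by
  have h := Theory.twoSit_forgetList α (D.omegaList α) _ (D.twoSit_inst_union α hT)
  unfold BAT.prog Theory.replaceSit
  rw [Set.image_image]
  exact Set.image_congr fun φ hφ => Formula.replaceSit_replaceSit α φ (h φ hφ)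

theorem BAT.uniform_prog {T : Theory L} (hT : ∀ φ ∈ T, Formula.Uniform φ .s0) :
    ∀ φ ∈ D.prog α T, Formula.Uniform φ .s0 := by
  have h := Theory.twoSit_forgetList α (D.omegaList α) _ (D.twoSit_inst_union α hT)
  rintro _ ⟨_, ⟨φ, hφ, rfl⟩, rfl⟩
  exact (Formula.uniform_replaceSit α φ (h φ hφ)).2

/-- `M` satisfies the progression of `T` iff the facts of `M` result, by the instantiated
successor state axioms, from facts that satisfy `T` and differ from them at most at the forgotten
atoms. -/
theorem BAT.models_prog {T : Theory L} (hT : ∀ φ ∈ T, Formula.Uniform φ .s0) (M : Str L) :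
    M.Models (D.prog α T) ↔
      ∃ R : Set M.Fact, (∀ y, (∀ p ∈ D.omega α, y ≠ p.fact M) → (y ∈ R ↔ y ∈ M.facts)) ∧
        (M.twoSit R M.facts).Models (D.inst α) ∧ (M.twoSit R M.facts).Models T := by
  have h2 := D.twoSit_inst_union α hT
  have h := Theory.twoSit_forgetList α (D.omegaList α) _ h2
  have h1 : M.Models (D.prog α T) ↔ (M.twoSit M.facts M.facts).Models
      (Theory.forgetList (D.inst α ∪ T) (D.omegaList α)) := by
    rw [D.prog_eq α hT]
    refine Set.forall_mem_image.trans (forall₂_congr fun φ hφ => ?_)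
    exact Formula.holds_atS0 α M φ (h φ hφ) _ _ _ _
  rw [h1, Theory.models_forgetList α _ _ h2]
  refine exists_congr fun R => and_congr (by simp only [BAT.mem_omegaList]) ?_
  exact ⟨fun h => ⟨fun φ hφ => h φ (Or.inl hφ), fun φ hφ => h φ (Or.inr hφ)⟩,
    fun h φ hφ => hφ.elim (h.1 φ) (h.2 φ)⟩

/-- The progression of `T` has the same consequences without fluents as `T`. -/
theorem BAT.entails_prog_iff {T : Theory L} (hT : ∀ φ ∈ T, Formula.Uniform φ .s0)
    {φ : Sentence L} (hφ : ∀ F, Symb.fluent F ∉ φ.sig) :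
    (D.prog α T).Entails φ ↔ T.Entails φ := by
  have key : ∀ (M : Str L) (R : Set M.Fact), (M.withFacts R).Models {φ} ↔ M.Models {φ} := by
    intro M R
    have h1 : ∀ N : Str L, N.Models {φ} ↔ φ.Holds N Fin.elim0 Fin.elim0 Fin.elim0 :=
      fun N => by simp [Str.Models]
    exact (h1 _).trans ((Formula.holds_withFacts M R φ hφ _ _ _).trans (h1 M).symm)
  constructor
  · intro h M hM
    -- The empty set at the later situation is a dummy: `effectAt` is uniform in `S₀`.
    let E : GroundAtom L → Prop := fun p =>
      (D.effectAt α p).Holds (M.twoSit M.facts ∅) Fin.elim0 Fin.elim0 Fin.elim0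
    -- The facts after the action: the prescribed effect at facts named by `Ω(S₀)`, inertia
    -- elsewhere.
    let R : Set M.Fact := {y | (∃ p ∈ D.omega α, y = p.fact M ∧ E p) ∨
      ((∀ p ∈ D.omega α, y ≠ p.fact M) ∧ y ∈ M.facts)}
    refine (key M R).1 (h _ ((D.models_prog α hT _).2 ⟨M.facts, fun y hy => ?_, ?_, ?_⟩))
    · change y ∈ M.facts ↔ y ∈ R
      refine ⟨fun h => Or.inr ⟨hy, h⟩, ?_⟩
      rintro (⟨p, hp, rfl, -⟩ | h)
      · exact (hy p hp rfl).elim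
      · exact h.2
    -- `twoSit` discards the fluents of the structure, so over `M.withFacts R` and over `M` it is
    -- the same structure.
    · change (M.twoSit M.facts R).Models _
      rintro _ ⟨p, hp, rfl⟩
      refine (D.holds_instAt α M _ _ p).2 ?_
      refine Iff.trans ?_ (Formula.holds_twoSit_congr M (R₁ := ∅) _ (D.uniform_effectAt α p)
        (fun _ _ => Iff.rfl) _ _ _)
      constructor
      · rintro (⟨q, hq, h1, h2⟩ | ⟨h1, -⟩)
        · exact (D.holds_effectAt_congr α M _ _ h1).2 h2
        · exact (h1 p hp rfl).elim
      · exact fun h => Or.inl ⟨p, hp, rfl, h⟩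
    · exact (Theory.models_iff_twoSit hT α M R).1 hM
  · intro h M hM
    obtain ⟨R, -, -, h1⟩ := (D.models_prog α hT M).1 hM
    -- Here `R` consists of the facts before the action, and giving them to `M` yields a model of
    -- `T`.
    refine (key M R).1 (h _ ?_)
    exact (Theory.models_iff_twoSit hT α (M.withFacts R) M.facts).2 h1

end Progression

/-! ### Signatures of substitution instances and connectives -/

section Sig

variable {n a s n' a' s' : ℕ}

theorem ObjTerm.sig_subst_subset {σ : Fin n → ObjTerm L n'} {X : Set (Symb L)}
    (hσ : ∀ i, (σ i).sig ⊆ X) (t : ObjTerm L n) (ht : t.sig ⊆ X) : (t.subst σ).sig ⊆ X := by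
  induction t with
  | var i => exact hσ i
  | const c => exact ht
  | func f ts ih =>
    simp only [ObjTerm.sig, Set.union_subset_iff, Set.iUnion_subset_iff] at ht
    simp only [ObjTerm.subst, ObjTerm.sig, Set.union_subset_iff, Set.iUnion_subset_iff]
    exact ⟨ht.1, fun i => ih i (ht.2 i)⟩

theorem ActTerm.sig_subst_subset {σ : Fin n → ObjTerm L n'} {τ : Fin a → ActTerm L n' a'}
    {X : Set (Symb L)} (hσ : ∀ i, (σ i).sig ⊆ X) (hτ : ∀ i, (τ i).sig ⊆ X) (t : ActTerm L n a)
    (ht : t.sig ⊆ X) : (t.subst σ τ).sig ⊆ X := by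
  cases t with
  | var i => exact hτ i
  | app A ts =>
    simp only [ActTerm.sig, Set.union_subset_iff, Set.iUnion_subset_iff] at ht
    simp only [ActTerm.subst, ActTerm.sig, Set.union_subset_iff, Set.iUnion_subset_iff]
    exact ⟨ht.1, fun i => ObjTerm.sig_subst_subset hσ _ (ht.2 i)⟩

theorem SitTerm.sig_subst_subset {σ : Fin n → ObjTerm L n'} {τ : Fin a → ActTerm L n' a'}
    {ρ : Fin s → SitTerm L n' a' s'} {X : Set (Symb L)} (hσ : ∀ i, (σ i).sig ⊆ X)
    (hτ : ∀ i, (τ i).sig ⊆ X) (hρ : ∀ i, (ρ i).sig ⊆ X) (u : SitTerm L n a s) (hu : u.sig ⊆ X) :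
    (u.subst σ τ ρ).sig ⊆ X := by
  induction u with
  | var i => exact hρ i
  | s0 => exact hu
  | doTerm t u ih =>
    simp only [SitTerm.sig, Set.union_subset_iff] at hu
    simp only [SitTerm.subst, SitTerm.sig, Set.union_subset_iff]
    exact ⟨⟨hu.1.1, t.sig_subst_subset hσ hτ hu.1.2⟩, ih hu.2⟩

theorem Formula.sig_subst_subset {X : Set (Symb L)} (φ : Formula L n a s) (hφ : φ.sig ⊆ X)
    {σ : Fin n → ObjTerm L n'} {τ : Fin a → ActTerm L n' a'} {ρ : Fin s → SitTerm L n' a' s'}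
    (hσ : ∀ i, (σ i).sig ⊆ X) (hτ : ∀ i, (τ i).sig ⊆ X) (hρ : ∀ i, (ρ i).sig ⊆ X) :
    (φ.subst σ τ ρ).sig ⊆ X := by
  -- Variables of either sort contribute no symbols. Both halves are indexed by one `Fin n`, hence
  -- the swapped parameters of `ActTerm`; `a := 0` is a filler where only the object half is used.
  have hvo : ∀ {n a} (i : Fin n), (ObjTerm.var i : ObjTerm L n).sig ⊆ X ∧
      (ActTerm.var i : ActTerm L a n).sig ⊆ X := fun i => ⟨Set.empty_subset _, Set.empty_subset _⟩
  have hvs : ∀ {n a s} (i : Fin s), (SitTerm.var i : SitTerm L n a s).sig ⊆ X :=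
    fun i => Set.empty_subset _
  induction φ generalizing n' a' s' with
  | falsum => exact Set.empty_subset _
  | eqObj t t' =>
    simp only [Formula.sig, Formula.subst, Set.union_subset_iff] at hφ ⊢
    exact ⟨t.sig_subst_subset hσ hφ.1, t'.sig_subst_subset hσ hφ.2⟩
  | eqAct t t' =>
    simp only [Formula.sig, Formula.subst, Set.union_subset_iff] at hφ ⊢
    exact ⟨t.sig_subst_subset hσ hτ hφ.1, t'.sig_subst_subset hσ hτ hφ.2⟩
  | eqSit t t' =>
    simp only [Formula.sig, Formula.subst, Set.union_subset_iff] at hφ ⊢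
    exact ⟨t.sig_subst_subset hσ hτ hρ hφ.1, t'.sig_subst_subset hσ hτ hρ hφ.2⟩
  | pred P ts =>
    simp only [Formula.sig, Formula.subst, Set.union_subset_iff, Set.iUnion_subset_iff] at hφ ⊢
    exact ⟨hφ.1, fun i => (ts i).sig_subst_subset hσ (hφ.2 i)⟩
  | fluent F ts u =>
    simp only [Formula.sig, Formula.subst, Set.union_subset_iff, Set.iUnion_subset_iff] at hφ ⊢
    exact ⟨⟨hφ.1.1, fun i => (ts i).sig_subst_subset hσ (hφ.1.2 i)⟩,
      u.sig_subst_subset hσ hτ hρ hφ.2⟩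
  | poss t u =>
    simp only [Formula.sig, Formula.subst, Set.union_subset_iff] at hφ ⊢
    exact ⟨⟨hφ.1.1, t.sig_subst_subset hσ hτ hφ.1.2⟩, u.sig_subst_subset hσ hτ hρ hφ.2⟩
  | prec t t' =>
    simp only [Formula.sig, Formula.subst, Set.union_subset_iff] at hφ ⊢
    exact ⟨⟨hφ.1.1, t.sig_subst_subset hσ hτ hρ hφ.1.2⟩, t'.sig_subst_subset hσ hτ hρ hφ.2⟩
  | imp φ ψ ih1 ih2 =>
    simp only [Formula.sig, Formula.subst, Set.union_subset_iff] at hφ ⊢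
    exact ⟨ih1 hφ.1 hσ hτ hρ, ih2 hφ.2 hσ hτ hρ⟩
  | allObj φ ih =>
    refine ih hφ (fun i => ?_) (fun i => ?_) (fun i => ?_)
    · refine Fin.lastCases ?_ (fun i => ?_) i
      · simpa using (hvo (a := 0) _).1
      · simpa [ObjTerm.wkObj] using (σ i).sig_subst_subset (fun i => (hvo (a := 0) _).1) (hσ i)
    · exact (τ i).sig_subst_subset (fun i => (hvo (a := 0) _).1) (fun i => (hvo _).2) (hτ i)
    · exact (ρ i).sig_subst_subset (fun i => (hvo (a := 0) _).1) (fun i => (hvo _).2) hvs (hρ i)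
  | allAct φ ih =>
    refine ih hφ hσ (fun i => ?_) (fun i => ?_)
    · refine Fin.lastCases ?_ (fun i => ?_) i
      · simpa using (hvo _).2
      · simpa [ActTerm.wkAct] using
          (τ i).sig_subst_subset (fun i => (hvo (a := 0) _).1) (fun i => (hvo _).2) (hτ i)
    · exact (ρ i).sig_subst_subset (fun i => (hvo (a := 0) _).1) (fun i => (hvo _).2) hvs (hρ i)
  | allSit φ ih =>
    refine ih hφ hσ hτ (fun i => ?_)
    refine Fin.lastCases ?_ (fun i => ?_) i
    · simpa using hvs _
    · rw [Fin.snoc_castSucc]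
      exact (ρ i).sig_subst_subset (fun i => (hvo (a := 0) _).1) (fun i => (hvo _).2)
        (fun i => hvs _) (hρ i)

theorem ObjTerm.sig_subset_subst (σ : Fin n → ObjTerm L n') (t : ObjTerm L n) :
    t.sig ⊆ (t.subst σ).sig := by
  induction t with
  | var i => exact Set.empty_subset _
  | const c => exact subset_rfl
  | func f ts ih => exact Set.union_subset_union_right _ (Set.iUnion_mono ih)

theorem ActTerm.sig_subset_subst (σ : Fin n → ObjTerm L n') (τ : Fin a → ActTerm L n' a')
    (t : ActTerm L n a) : t.sig ⊆ (t.subst σ τ).sig := by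
  cases t with
  | var i => exact Set.empty_subset _
  | app A ts =>
    exact Set.union_subset_union_right _ (Set.iUnion_mono fun i => (ts i).sig_subset_subst σ)

theorem SitTerm.sig_subset_subst (σ : Fin n → ObjTerm L n') (τ : Fin a → ActTerm L n' a')
    (ρ : Fin s → SitTerm L n' a' s') (u : SitTerm L n a s) : u.sig ⊆ (u.subst σ τ ρ).sig := by
  induction u with
  | var i => exact Set.empty_subset _
  | s0 => exact subset_rfl
  | doTerm t u ih =>
    exact Set.union_subset_union (Set.union_subset_union_right _ (t.sig_subset_subst σ τ)) ih

/-- Substitution acts only on variables and loses no symbol. This bounds the symbols of an effect's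
context by those of the successor state axiom, where the context occurs under a substitution. -/
theorem Formula.sig_subset_subst (φ : Formula L n a s) (σ : Fin n → ObjTerm L n')
    (τ : Fin a → ActTerm L n' a') (ρ : Fin s → SitTerm L n' a' s') :
    φ.sig ⊆ (φ.subst σ τ ρ).sig := by
  induction φ generalizing n' a' s' with
  | falsum => exact subset_rfl
  | eqObj t t' => exact Set.union_subset_union (t.sig_subset_subst _) (t'.sig_subset_subst _)
  | eqAct t t' => exact Set.union_subset_union (t.sig_subset_subst _ _) (t'.sig_subset_subst _ _)
  | eqSit t t' =>
    exact Set.union_subset_union (t.sig_subset_subst _ _ _) (t'.sig_subset_subst _ _ _)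
  | pred P ts =>
    exact Set.union_subset_union_right _ (Set.iUnion_mono fun i => (ts i).sig_subset_subst _)
  | fluent F ts u =>
    exact Set.union_subset_union (Set.union_subset_union_right _
      (Set.iUnion_mono fun i => (ts i).sig_subset_subst _)) (u.sig_subset_subst _ _ _)
  | poss t u =>
    exact Set.union_subset_union (Set.union_subset_union_right _ (t.sig_subset_subst _ _))
      (u.sig_subset_subst _ _ _)
  | prec t t' =>
    exact Set.union_subset_union (Set.union_subset_union_right _ (t.sig_subset_subst _ _ _))
      (t'.sig_subset_subst _ _ _)
  | imp φ ψ ih1 ih2 => exact Set.union_subset_union (ih1 _ _ _) (ih2 _ _ _)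
  | allObj φ ih => exact ih _ _ _
  | allAct φ ih => exact ih _ _ _
  | allSit φ ih => exact ih _ _ _

theorem Formula.sig_neg (φ : Formula L n a s) : φ.neg.sig = φ.sig := Set.union_empty _

theorem Formula.sig_verum : (verum : Formula L n a s).sig = ∅ := Set.union_empty _

theorem Formula.sig_or (φ ψ : Formula L n a s) : (φ.or ψ).sig = φ.sig ∪ ψ.sig := by
  simp [Formula.or, Formula.neg, Formula.sig]

theorem Formula.sig_and (φ ψ : Formula L n a s) : (φ.and ψ).sig = φ.sig ∪ ψ.sig := by
  simp [Formula.and, Formula.neg, Formula.sig]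

theorem Formula.sig_iff (φ ψ : Formula L n a s) : (φ.iff ψ).sig = φ.sig ∪ ψ.sig := by
  simp only [Formula.iff, Formula.sig_and, Formula.sig]
  rw [Set.union_comm ψ.sig, Set.union_self]

theorem Formula.sig_bigOr (l : List (Formula L n a s)) : (bigOr l).sig = ⋃ φ ∈ l, φ.sig := by
  induction l with
  | nil => simp [bigOr, Formula.sig]
  | cons φ l ih =>
    simp only [bigOr, List.foldr] at ih ⊢
    simp [Formula.sig_or, ih, Set.iUnion_or, Set.iUnion_union_distrib]

theorem Formula.sig_bigAnd (l : List (Formula L n a s)) : (bigAnd l).sig = ⋃ φ ∈ l, φ.sig := by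
  induction l with
  | nil => simp [bigAnd, Formula.sig_verum]
  | cons φ l ih =>
    simp only [bigAnd, List.foldr] at ih ⊢
    simp [Formula.sig_and, ih, Set.iUnion_or, Set.iUnion_union_distrib]

theorem Formula.sig_eqVec {k : ℕ} (t t' : Fin k → ObjTerm L n) :
    (eqVec t t' : Formula L n a s).sig = ⋃ i, ((t i).sig ∪ (t' i).sig) := by
  ext x
  simp [eqVec, Formula.sig_bigAnd, List.mem_ofFn, Formula.sig]

theorem Formula.sig_exObjs (m : ℕ) (φ : Formula L (n + m) a s) : (exObjs m φ).sig = φ.sig := by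
  induction m with
  | zero => rfl
  | succ m ih =>
    rw [Formula.exObjs, ih]
    simp [Formula.exObj, Formula.neg, Formula.sig]

theorem Formula.sig_allObjs (n : ℕ) (φ : Formula L n a s) : (allObjs n φ).sig = φ.sig := by
  induction n with
  | zero => rfl
  | succ n ih => exact ih _

theorem GroundAtom.sig_toFormula (p : GroundAtom L) :
    (p.toFormula : Formula L n a s).sig =
      {.fluent p.1, .s0} ∪ Set.range fun i => Symb.const (p.2 i) := by
  ext x
  simp [GroundAtom.toFormula, Formula.sig, ObjTerm.sig, SitTerm.sig]
  tauto

/-- Uniformity leaves situation terms only as arguments of fluents, and there they are `S₀`. -/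
theorem Formula.doSym_notMem_of_uniform (φ : Formula L n a s) (h : φ.Uniform .s0) :
    Symb.doSym ∉ φ.sig := by
  have ho : ∀ {n} (t : ObjTerm L n), Symb.doSym ∉ t.sig := by
    intro n t
    induction t with
    | func f ts ih => simpa [ObjTerm.sig] using ih
    | _ => simp [ObjTerm.sig]
  have ha : ∀ {n a} (t : ActTerm L n a), Symb.doSym ∉ t.sig := by
    intro n a t
    cases t <;> simp [ActTerm.sig, ho]
  induction φ with
  | fluent F ts u =>
    cases h
    simp [Formula.sig, SitTerm.sig, ho]
  | imp φ ψ ih1 ih2 => exact fun hd => hd.elim (ih1 h.1) (ih2 h.2)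
  | allObj φ ih => exact ih h
  | allAct φ ih => exact ih h
  | eqSit _ _ => exact h.elim
  | poss _ _ => exact h.elim
  | prec _ _ => exact h.elim
  | allSit _ => exact h.elim
  | _ => simp [Formula.sig, ho, ha]

theorem Formula.s0_mem_of_fluent_mem {F : L.Fluent} (φ : Formula L n a s) (h : φ.Uniform .s0)
    (hF : Symb.fluent F ∈ φ.sig) : Symb.s0 ∈ φ.sig := by
  have ho : ∀ {n} (t : ObjTerm L n), Symb.fluent F ∉ t.sig := by
    intro n t
    induction t with
    | func f ts ih => simpa [ObjTerm.sig] using ih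
    | _ => simp [ObjTerm.sig]
  have ha : ∀ {n a} (t : ActTerm L n a), Symb.fluent F ∉ t.sig := by
    intro n a t
    cases t <;> simp [ActTerm.sig, ho]
  induction φ with
  | fluent F ts u =>
    cases h
    simp [Formula.sig, SitTerm.sig]
  | imp φ ψ ih1 ih2 => exact hF.imp (ih1 h.1) (ih2 h.2)
  | allObj φ ih => exact ih h hF
  | allAct φ ih => exact ih h hF
  | eqSit _ _ => exact h.elim
  | poss _ _ => exact h.elim
  | prec _ _ => exact h.elim
  | allSit _ => exact h.elim
  | _ => simp [Formula.sig, ho, ha] at hF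

end Sig

theorem Theory.mem_sig {T : Theory L} {x : Symb L} : x ∈ T.sig ↔ ∃ φ ∈ T, x ∈ Formula.sig φ := by
  simp [Theory.sig]

/-! ### Signatures of forgetting -/

section Forget

variable {n a s : ℕ}

/-- The symbols that the atoms `F(t̄, u)` of a formula with `u ≠ S₀` have at `S₀`. -/
def Formula.laterSig : {n a s : ℕ} → Formula L n a s → Set (Symb L)
  | _, _, _, .fluent F ts u =>
      {x | u ≠ .s0 ∧ (x ∈ ({.fluent F, .s0} : Set (Symb L)) ∨ ∃ i, x ∈ (ts i).sig)}
  | _, _, _, .imp φ ψ => φ.laterSig ∪ ψ.laterSig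
  | _, _, _, .allObj φ => φ.laterSig
  | _, _, _, .allAct φ => φ.laterSig
  | _, _, _, .allSit φ => φ.laterSig
  | _, _, _, _ => ∅

theorem Formula.laterSig_subset (φ : Formula L n a s) : φ.laterSig ⊆ φ.atS0.sig := by
  induction φ with
  | fluent F ts u =>
    rintro x ⟨-, (rfl | rfl) | hx⟩
    · simp [Formula.atS0, Formula.sig]
    · simp [Formula.atS0, Formula.sig, SitTerm.sig]
    · exact Or.inl (Or.inr (Set.mem_iUnion.2 hx))
  | imp φ ψ ih1 ih2 => exact Set.union_subset_union ih1 ih2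
  | allObj φ ih => exact ih
  | allAct φ ih => exact ih
  | allSit φ ih => exact ih
  | _ => exact Set.empty_subset _

theorem Formula.laterSig_of_uniform (φ : Formula L n a s) (h : φ.Uniform .s0) :
    φ.laterSig = ∅ := by
  induction φ with
  | fluent F ts u =>
    cases h
    simp [Formula.laterSig]
  | imp φ ψ ih1 ih2 => simp [Formula.laterSig, ih1 h.1, ih2 h.2]
  | allObj φ ih => exact ih h
  | allAct φ ih => exact ih h
  | allSit φ => exact h.elim
  | _ => rfl

theorem Formula.laterSig_or (φ ψ : Formula L n a s) :
    (φ.or ψ).laterSig = φ.laterSig ∪ ψ.laterSig := by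
  simp [Formula.or, Formula.neg, Formula.laterSig]

theorem Formula.uniform_eqVec {k : ℕ} (t t' : Fin k → ObjTerm L n) (S : SitTerm L n a s) :
    (eqVec t t' : Formula L n a s).Uniform S := by
  refine Formula.uniform_bigAnd _ _ fun φ hφ => ?_
  obtain ⟨i, rfl⟩ := List.mem_ofFn.1 hφ
  trivial

theorem Formula.uniform_fluent (F : L.Fluent) (ts : Fin (L.fluentArity F) → ObjTerm L n) :
    (fluent F ts .s0 : Formula L n a s).Uniform .s0 := by
  rw [Formula.Uniform]

theorem Formula.uniform_ofBool (b : Bool) (S : SitTerm L n a s) :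
    (ofBool b : Formula L n a s).Uniform S := by
  cases b
  · exact trivial
  · exact ⟨trivial, trivial⟩

theorem Formula.sig_ofBool (b : Bool) : (ofBool b : Formula L n a s).sig = ∅ := by
  cases b
  · rfl
  · exact Formula.sig_verum

theorem Formula.uniform_setAtom_bracket_fluent (F : L.Fluent)
    (t : Fin (L.fluentArity F) → L.Const) (b : Bool)
    (ts : Fin (L.fluentArity F) → ObjTerm L n) :
    (((Formula.fluent F ts .s0 : Formula L n a s).bracket ⟨F, t⟩).setAtom ⟨F, t⟩ b).Uniform
      .s0 := by
  rw [Formula.setAtom_bracket_fluent]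
  refine ⟨⟨⟨⟨Formula.uniform_eqVec _ _ _, Formula.uniform_ofBool b _, trivial⟩, trivial⟩, trivial⟩,
    ⟨⟨Formula.uniform_eqVec _ _ _, trivial⟩, ?_, trivial⟩, trivial⟩
  split
  · exact Formula.uniform_ofBool b _
  · exact rfl

/-- Forgetting touches only atoms at `S₀`, so what the later atoms contribute survives. This yields
the lower bound on the signature of a progression. -/
theorem Formula.laterSig_setAtom_bracket (p : GroundAtom L) (b : Bool) (φ : Formula L n a s) :
    ((φ.bracket p).setAtom p b).laterSig = φ.laterSig := by
  induction φ with
  | fluent F ts u =>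
    by_cases hp : F = p.1 ∧ u = .s0
    · obtain ⟨G, t⟩ := p
      obtain ⟨rfl, rfl⟩ := hp
      rw [Formula.laterSig_of_uniform _ (Formula.uniform_setAtom_bracket_fluent F t b ts)]
      exact (Formula.laterSig_of_uniform (.fluent F ts .s0) (Formula.uniform_fluent F ts)).symm
    · rw [Formula.setAtom_bracket_of_ne p b F ts u hp]
  | imp φ ψ ih1 ih2 => exact congrArg₂ (· ∪ ·) ih1 ih2
  | allObj φ ih => exact ih
  | allAct φ ih => exact ih
  | allSit φ ih => exact ih
  | _ => rfl

/-- The symbols of `p` are added on both sides because forgetting can create them, through the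
equalities with its constants, or destroy them, where the atom is literally `p`. No other symbol is
affected. -/
theorem Formula.sig_atS0_setAtom_bracket (p : GroundAtom L) (b : Bool) (φ : Formula L n a s) :
    ((φ.bracket p).setAtom p b).atS0.sig ∪ (p.toFormula : Sentence L).sig =
      φ.atS0.sig ∪ (p.toFormula : Sentence L).sig := by
  induction φ with
  | fluent F ts u =>
    by_cases hp : F = p.1 ∧ u = .s0
    · obtain ⟨G, t⟩ := p
      obtain ⟨rfl, rfl⟩ := hp
      rw [Formula.atS0_of_uniform _ (Formula.uniform_setAtom_bracket_fluent F t b ts),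
        Formula.setAtom_bracket_fluent]
      simp only [Formula.atS0, Formula.sig_or, Formula.sig_and, Formula.sig_neg,
        Formula.sig_eqVec, Formula.sig_ofBool, GroundAtom.sig_toFormula, Set.iUnion_union_distrib]
      ext x
      split <;> simp [Formula.sig, ObjTerm.sig, SitTerm.sig, Formula.sig_ofBool] <;> tauto
    · rw [Formula.setAtom_bracket_of_ne p b F ts u hp]
  | imp φ ψ ih1 ih2 =>
    simp only [Formula.bracket, Formula.setAtom, Formula.atS0, Formula.sig] at ih1 ih2 ⊢
    rw [Set.union_union_distrib_right, ih1, ih2, ← Set.union_union_distrib_right]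
  | allObj φ ih => exact ih
  | allAct φ ih => exact ih
  | allSit φ ih => exact ih
  | _ => rfl

theorem Theory.exists_laterSig_forgetList (ω : List (GroundAtom L)) (T : Theory L) (x : Symb L) :
    (∃ φ ∈ T.forgetList ω, x ∈ Formula.laterSig φ) ↔ ∃ φ ∈ T, x ∈ Formula.laterSig φ := by
  induction ω generalizing T with
  | nil => exact Iff.rfl
  | cons p ω ih =>
    refine (ih (T.forget p)).trans ⟨?_, ?_⟩
    · rintro ⟨_, ⟨φ, hφ, ψ, hψ, rfl⟩, hx⟩
      rw [Formula.laterSig_or, Formula.laterSig_setAtom_bracket,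
        Formula.laterSig_setAtom_bracket] at hx
      exact hx.elim (fun h => ⟨φ, hφ, h⟩) fun h => ⟨ψ, hψ, h⟩
    · rintro ⟨φ, hφ, hx⟩
      refine ⟨_, ⟨φ, hφ, φ, hφ, rfl⟩, ?_⟩
      rw [Formula.laterSig_or, Formula.laterSig_setAtom_bracket]
      exact Or.inl hx

theorem Formula.atS0_or (φ ψ : Formula L n a s) : (φ.or ψ).atS0 = φ.atS0.or ψ.atS0 := rfl

theorem Theory.exists_sig_atS0_forget (p : GroundAtom L) (T : Theory L) (x : Symb L) :
    ((∃ φ ∈ T.forget p, x ∈ φ.atS0.sig) ∨ x ∈ (p.toFormula : Sentence L).sig) ↔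
      ((∃ φ ∈ T, x ∈ φ.atS0.sig) ∨ x ∈ (p.toFormula : Sentence L).sig) := by
  have h : ∀ (φ : Sentence L) b, x ∈ _ ∪ _ ↔ x ∈ _ ∪ _ := fun φ b =>
    Set.ext_iff.1 (Formula.sig_atS0_setAtom_bracket p b φ) x
  simp only [Set.mem_union] at h
  constructor
  · rintro (⟨_, ⟨φ, hφ, ψ, hψ, rfl⟩, hx⟩ | hx)
    · rw [Formula.atS0_or, Formula.sig_or] at hx
      rcases hx with hx | hx
      · exact ((h φ true).1 (Or.inl hx)).imp_left fun hx => ⟨φ, hφ, hx⟩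
      · exact ((h ψ false).1 (Or.inl hx)).imp_left fun hx => ⟨ψ, hψ, hx⟩
    · exact Or.inr hx
  · rintro (⟨φ, hφ, hx⟩ | hx)
    · refine ((h φ true).2 (Or.inl hx)).imp_left fun hx => ⟨_, ⟨φ, hφ, φ, hφ, rfl⟩, ?_⟩
      rw [Formula.atS0_or, Formula.sig_or]
      exact Or.inl hx
    · exact Or.inr hx

theorem Theory.exists_sig_atS0_forgetList (ω : List (GroundAtom L)) (T : Theory L) (x : Symb L) :
    ((∃ φ ∈ T.forgetList ω, x ∈ φ.atS0.sig) ∨ ∃ p ∈ ω, x ∈ (p.toFormula : Sentence L).sig) ↔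
      ((∃ φ ∈ T, x ∈ φ.atS0.sig) ∨ ∃ p ∈ ω, x ∈ (p.toFormula : Sentence L).sig) := by
  induction ω generalizing T with
  | nil => exact Iff.rfl
  | cons p ω ih =>
    have h1 := ih (T.forget p)
    have h2 := Theory.exists_sig_atS0_forget p T x
    simp only [List.mem_cons, or_and_right, exists_or, exists_eq_left] at h1 h2 ⊢
    have h3 : ∀ A B C P Q : Prop, (A ∨ Q ↔ B ∨ Q) → (B ∨ P ↔ C ∨ P) →
        (A ∨ P ∨ Q ↔ C ∨ P ∨ Q) := by
      intro A B C P Q h1 h2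
      rw [or_left_comm, h1, ← or_assoc, or_comm (a := P), h2, or_assoc]
    exact h3 _ _ _ _ _ h1 h2

end Forget

/-! ### The signature of a progression -/

section Progression

variable (D : BAT L) (α : GroundAction L)

/-- The symbols of the instantiated successor state axioms, stated at `S₀`. -/
def BAT.instSig : Set (Symb L) :=
  ⋃ p ∈ D.omega α, (p.toFormula : Sentence L).sig ∪ (D.effectAt α p).sig

theorem BAT.sig_atS0_instAt (p : GroundAtom L) :
    (D.instAt α p).atS0.sig = (p.toFormula : Sentence L).sig ∪ (D.effectAt α p).sig := by
  have h : (D.instAt α p).atS0 = .iff p.toFormula (D.effectAt α p).atS0 := rfl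
  rw [h, Formula.sig_iff, Formula.atS0_of_uniform _ (D.uniform_effectAt α p)]

theorem BAT.sig_toFormula_subset_laterSig (p : GroundAtom L) :
    (p.toFormula : Sentence L).sig ⊆ (D.instAt α p).laterSig := by
  intro x hx
  refine Or.inl (Or.inl (Or.inl ⟨by simp [GroundAction.sit], ?_⟩))
  rw [GroundAtom.sig_toFormula] at hx
  refine hx.imp id ?_
  rintro ⟨i, rfl⟩
  exact ⟨i, rfl⟩

/-- Up to the symbols of the forgotten atoms, forgetting preserves the signature; and these symbols
are not lost, because each forgotten atom also occurs, at `S_α`, as the left-hand side of its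
instantiated axiom. An exact equality is needed, since a decomposition must have precisely the
signature of the theory. -/
theorem BAT.sig_prog [Finite L.Fluent] {T : Theory L} (hT : ∀ φ ∈ T, Formula.Uniform φ .s0) :
    (D.prog α T).sig = T.sig ∪ D.instSig α := by
  ext x
  have h1 : x ∈ (D.prog α T).sig ↔
      ∃ φ ∈ Theory.forgetList (D.inst α ∪ T) (D.omegaList α), x ∈ φ.atS0.sig := by
    rw [D.prog_eq α hT, Theory.mem_sig, Set.exists_mem_image]
  have h2 : (∃ φ ∈ D.inst α ∪ T, x ∈ φ.atS0.sig) ↔ x ∈ T.sig ∪ D.instSig α := by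
    have h3 : (∃ φ ∈ T, x ∈ φ.atS0.sig) ↔ x ∈ T.sig := by
      rw [Theory.mem_sig]
      refine exists_congr fun φ => and_congr_right fun hφ => ?_
      rw [Formula.atS0_of_uniform φ (hT φ hφ)]
    have h4 : (∃ φ ∈ D.inst α, x ∈ φ.atS0.sig) ↔ x ∈ D.instSig α := by
      simp only [BAT.inst, Set.exists_mem_image, BAT.sig_atS0_instAt, BAT.instSig,
        Set.mem_iUnion, exists_prop]
    rw [Set.mem_union, ← h3, ← h4]
    simp only [Set.mem_union, or_and_right, exists_or]
    exact or_comm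
  have h3 := Theory.exists_sig_atS0_forgetList (D.omegaList α) (D.inst α ∪ T) x
  rw [h2, ← h1] at h3
  simp only [BAT.mem_omegaList] at h3
  constructor
  · intro hx
    rcases h3.1 (Or.inl hx) with h | ⟨p, hp, h⟩
    · exact h
    · exact Or.inr (Set.mem_iUnion₂.2 ⟨p, hp, Or.inl h⟩)
  · intro hx
    rcases h3.2 (Or.inl hx) with h | ⟨p, hp, h⟩
    · exact h
    -- The symbols of a forgotten atom are recovered from its copy at `S_α`, which moves to `S₀`
    -- afterwards.
    · obtain ⟨φ, hφ, h⟩ :=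
        (Theory.exists_laterSig_forgetList (D.omegaList α) (D.inst α ∪ T) x).2
          ⟨_, Or.inl ⟨p, hp, rfl⟩, D.sig_toFormula_subset_laterSig α p h⟩
      exact h1.2 ⟨φ, hφ, φ.laterSig_subset h⟩

/-- Groups of axioms may share `do` outside `Δ₁`, so it must be ruled out as a new symbol. -/
theorem BAT.doSym_notMem_instSig : Symb.doSym ∉ D.instSig α := by
  simp only [BAT.instSig, Set.mem_iUnion, not_exists]
  rintro p - (h | h)
  · exact Formula.doSym_notMem_of_uniform p.toFormula (Formula.uniform_fluent _ _) h
  · exact Formula.doSym_notMem_of_uniform _ (D.uniform_effectAt α p) h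

theorem Effect.sig_resolve_subset {n : ℕ} (e : Effect L n) :
    (e.resolve α).sig ⊆ α.consts ∪ e.toFormula.sig := by
  unfold Effect.resolve
  split
  · rw [Effect.toFormula, Formula.sig_exObjs, Formula.sig_exObjs, Formula.sig_and,
      Formula.sig_and, Formula.sig_eqVec]
    refine Set.union_subset (Set.iUnion_subset fun i => Set.union_subset ?_ ?_) ?_
    · rintro _ rfl
      exact Or.inl ⟨_, rfl⟩
    · exact fun x hx => Or.inr (Or.inl (Or.inr (Or.inr (Set.mem_iUnion.2 ⟨i, hx⟩))))
    · exact fun x hx => Or.inr (Or.inr (Formula.sig_subset_subst _ _ _ _ hx))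
  · exact Set.empty_subset _

theorem sig_gammaAt_subset {n : ℕ} (l : List (Effect L n)) (t : Fin n → L.Const) :
    (gammaAt α l t).sig ⊆ {.s0} ∪ (Set.range fun i => Symb.const (t i)) ∪ α.consts ∪
      ⋃ e ∈ l, e.toFormula.sig := by
  refine Formula.sig_subst_subset _ ?_ (fun i => ?_) (fun i => i.elim0) (fun _ => ?_)
  · rw [Formula.sig_bigOr]
    refine Set.iUnion₂_subset fun φ hφ => ?_
    obtain ⟨e, he, rfl⟩ := List.mem_map.1 hφ
    intro x hx
    rcases e.sig_resolve_subset α hx with h | h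
    · exact Or.inl (Or.inr h)
    · exact Or.inr (Set.mem_iUnion₂.2 ⟨e, he, h⟩)
  · rintro _ rfl
    exact Or.inl (Or.inl (Or.inr ⟨i, rfl⟩))
  · exact fun x hx => Or.inl (Or.inl (Or.inl hx))

theorem SSA.sig_toSentence {F : L.Fluent} (ax : SSA L F) :
    ax.toSentence.sig = {.fluent F, .doSym} ∪ ⋃ e ∈ ax.pos ++ ax.neg, e.toFormula.sig := by
  have h : ax.toSentence.sig = (Formula.allObjs _ _).sig := rfl
  rw [h, Formula.sig_allObjs]
  ext x
  simp only [Formula.sig_iff, Formula.sig_or, Formula.sig_and, Formula.sig_neg, Formula.sig_bigOr]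
  simp [Formula.sig, ObjTerm.sig, ActTerm.sig, SitTerm.sig, or_and_right, exists_or,
    or_comm (a := x = Symb.doSym)]

/-- By the definition of `Ω(S₀)`, the constants of its atoms are arguments of `α`; rewriting action
equalities likewise introduces no constants but these. -/
theorem BAT.instSig_subset :
    D.instSig α ⊆ {x | ∃ p ∈ D.omega α,
      x = .s0 ∨ x ∈ α.consts ∨ x ∈ (D.ssa p.1).toSentence.sig} := by
  refine Set.iUnion₂_subset fun p hp => ?_
  have hc : (Set.range fun i => Symb.const (p.2 i)) ⊆ α.consts := by
    rintro _ ⟨i, rfl⟩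
    obtain ⟨e, -, h, he⟩ := hp
    obtain ⟨k, -, hk⟩ := he i
    exact ⟨_, congrArg Symb.const hk.symm⟩
  have ha : ∀ x ∈ (p.toFormula : Sentence L).sig,
      x = .s0 ∨ x ∈ α.consts ∨ x ∈ (D.ssa p.1).toSentence.sig := by
    rw [GroundAtom.sig_toFormula, SSA.sig_toSentence]
    rintro x ((rfl | rfl) | hx)
    · simp
    · exact Or.inl rfl
    · exact Or.inr (Or.inl (hc hx))
  have hg : ∀ l, (∀ e ∈ l, e ∈ (D.ssa p.1).pos ++ (D.ssa p.1).neg) →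
      ∀ x ∈ (gammaAt α l p.2).sig,
        x = .s0 ∨ x ∈ α.consts ∨ x ∈ (D.ssa p.1).toSentence.sig := by
    intro l hl x hx
    rw [SSA.sig_toSentence]
    rcases sig_gammaAt_subset α l p.2 hx with ((h | h) | h) | h
    · exact Or.inl h
    · exact Or.inr (Or.inl (hc h))
    · exact Or.inr (Or.inl h)
    · obtain ⟨e, he, h⟩ := Set.mem_iUnion₂.1 h
      exact Or.inr (Or.inr (Or.inr (Set.mem_iUnion₂.2 ⟨e, hl e he, h⟩)))
  rintro x (hx | hx)
  · exact ⟨p, hp, ha x hx⟩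
  · rw [BAT.effectAt, Formula.sig_or, Formula.sig_and, Formula.sig_neg] at hx
    rcases hx with h | h | h
    · exact ⟨p, hp, hg _ (fun e he => List.mem_append_left _ he) x h⟩
    · exact ⟨p, hp, ha x h⟩
    · exact ⟨p, hp, hg _ (fun e he => List.mem_append_right _ he) x h⟩

end Progression

/-! ### Preservation of the components -/

section Preservation

theorem Theory.finite_forget {T : Theory L} (hT : T.Finite) (p : GroundAtom L) :
    (T.forget p).Finite := by
  refine (Set.Finite.image2 (fun φ ψ : Sentence L =>
    ((φ.bracket p).setAtom p true).or ((ψ.bracket p).setAtom p false)) hT hT).subset ?_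
  rintro _ ⟨φ, hφ, ψ, hψ, rfl⟩
  exact ⟨φ, hφ, ψ, hψ, rfl⟩

theorem Theory.finite_forgetList {T : Theory L} (hT : T.Finite) (ω : List (GroundAtom L)) :
    (T.forgetList ω).Finite := by
  induction ω generalizing T with
  | nil => exact hT
  | cons p ω ih => exact ih (Theory.finite_forget hT p)

theorem BAT.finite_prog [Finite L.Fluent] (D : BAT L) (α : GroundAction L) {T : Theory L}
    (hT : T.Finite) : (D.prog α T).Finite :=
  ((Theory.finite_forgetList (((D.omega_finite α).image _).union hT) _).image _).image _

theorem BAT.active_of_mem_omega {D : BAT L} {α : GroundAction L} {p : GroundAtom L}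
    (hp : p ∈ D.omega α) : (D.ssa p.1).Active α.act := by
  obtain ⟨e, he, h, -⟩ := hp
  exact ⟨e, he, h⟩

theorem SSA.action_mem_sig {F : L.Fluent} {ax : SSA L F} {A : L.Action} (h : ax.Active A) :
    Symb.action A ∈ ax.toSentence.sig := by
  obtain ⟨e, he, rfl⟩ := h
  rw [SSA.sig_toSentence]
  refine Or.inr (Set.mem_iUnion₂.2 ⟨e, he, ?_⟩)
  rw [Effect.toFormula, Formula.sig_exObjs, Formula.sig_and]
  exact Or.inl (Or.inr (Or.inl rfl))

/-! ### The component affected by the action. -/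

variable {D : BAT L} {α : GroundAction L} {Δ₁ Δ₂ : Set (Symb L)} {I J : Type*} {DI : I → Theory L}
  {C : J → Theory L}

theorem PreservationConditions.exists_mem_group (h : PreservationConditions D α Δ₁ Δ₂ DI C)
    (F : L.Fluent) : ∃ i, (D.ssa F).toSentence ∈ DI i := by
  have h1 : (D.ssa F).toSentence ∈ D.ssTheory := ⟨F, rfl⟩
  rw [h.ss_eq] at h1
  exact Set.mem_iUnion.1 h1

/-- Every fluent of the language has a successor state axiom, so the condition on fluents of `D_ss`
reaches all of them. In particular progression introduces no new fluent. -/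
theorem PreservationConditions.fluent_mem_init (h : PreservationConditions D α Δ₁ Δ₂ DI C)
    (F : L.Fluent) : Symb.fluent F ∈ D.init.sig := by
  refine h.fluents F (Theory.mem_sig.2 ⟨_, ⟨F, rfl⟩, ?_⟩)
  rw [SSA.sig_toSentence]
  exact Or.inl (Or.inl rfl)

theorem IsDecomposition.sig_subset {Δ : Set (Symb L)} {T : Theory L} (h : IsDecomposition Δ T C)
    (j : J) : (C j).sig ⊆ T.sig := by
  rw [← h.union_eq]
  exact Set.subset_iUnion (fun j => (C j).sig) j

theorem IsDecomposition.subset_sig_component {Δ : Set (Symb L)} {T : Theory L}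
    (h : IsDecomposition Δ T C) (j : J) : Δ ⊆ (C j).sig := by
  have := h.nontrivial
  obtain ⟨k, hk⟩ := exists_ne j
  rw [← h.inter_eq j k hk.symm]
  exact Set.inter_subset_left

/-- The action function of `α` occurs actively in the axioms of one group only, and this group is
aligned with one component, which contains all fluents affected by `α`. -/
theorem StrongPreservationConditions.exists_component
    (h : StrongPreservationConditions D α Δ₁ Δ₂ DI C) :
    ∃ i j, (DI i).sig ∩ D.init.sig ⊆ (C j).sig ∧
      (∀ p ∈ D.omega α, (D.ssa p.1).toSentence ∈ DI i) ∧
      ((D.omega α).Nonempty → α.consts ⊆ (C j).sig ∧ Symb.s0 ∈ (C j).sig) := by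
  have hfl : ∀ i j, (DI i).sig ∩ D.init.sig ⊆ (C j).sig → ∀ F, (D.ssa F).toSentence ∈ DI i →
      Symb.fluent F ∈ (C j).sig := by
    intro i j hij F hF
    refine hij ⟨Theory.mem_sig.2 ⟨_, hF, ?_⟩, h.fluent_mem_init F⟩
    rw [SSA.sig_toSentence]
    exact Or.inl (Or.inl rfl)
  by_cases hne : (D.omega α).Nonempty
  · obtain ⟨p, hp⟩ := hne
    obtain ⟨i, hi⟩ := h.exists_mem_group p.1
    obtain ⟨j, hj⟩ := h.aligned i
    have hF := hfl i j hj p.1 hi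
    refine ⟨i, j, hj, fun q hq => ?_, fun _ =>
      ⟨h.consts_subset j p.1 hF (BAT.active_of_mem_omega hp), ?_⟩⟩
    · obtain ⟨k, hk⟩ := h.exists_mem_group q.1
      by_cases hik : i = k
      · rwa [hik]
      · exfalso
        -- Two distinct groups would share the action symbol of `α`, which is neither `do` nor in
        -- `Δ₁`.
        rcases h.ss_inter i k hik ⟨Theory.mem_sig.2 ⟨_, hi,
            SSA.action_mem_sig (BAT.active_of_mem_omega hp)⟩, Theory.mem_sig.2 ⟨_, hk,
            SSA.action_mem_sig (BAT.active_of_mem_omega hq)⟩⟩ with h1 | h1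
        · exact h.no_action _ h1
        · simp at h1
    · obtain ⟨φ, hφ, h1⟩ := Theory.mem_sig.1 hF
      exact Theory.mem_sig.2 ⟨φ, hφ, φ.s0_mem_of_fluent_mem (h.uniform j φ hφ) h1⟩
  -- If `α` affects nothing, any group and a component aligned with it will do.
  · obtain ⟨i⟩ := h.nonempty
    obtain ⟨j, hj⟩ := h.aligned i
    exact ⟨i, j, hj, fun p hp => (hne ⟨p, hp⟩).elim, fun h => (hne h).elim⟩

theorem FluentFree.union_consts (h₁ : FluentFree Δ₁) (h₂ : FluentFree Δ₂)
    (β : GroundAction L) : FluentFree (Δ₁ ∪ Δ₂ ∪ β.consts) := by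
  rintro F ((h | h) | ⟨k, h⟩)
  · exact h₁ F h
  · exact h₂ F h
  · simp at h

/-! ### Progressing a single component. -/

variable [Finite L.Fluent]

/-- Forgetting in the union can be restricted to the component that contains the fluents
affected by `α`. -/
theorem IsDecomposition.equiv_prog [DecidableEq J] (h : IsDecomposition Δ₂ D.init C)
    (hu : ∀ j, ∀ φ ∈ C j, Formula.Uniform φ .s0) {j : J}
    (hj : ∀ k, k ≠ j → ∀ p ∈ D.omega α, Symb.fluent p.1 ∉ (C k).sig) :
    (D.prog α D.init).Equiv (⋃ k, Function.update C j (D.prog α (C j)) k) := by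
  -- The facts before and after the action differ only at affected fluents, which the components
  -- other than `C j` do not mention.
  have hother : ∀ (M : Str L) (R : Set M.Fact),
      (∀ y, (∀ p ∈ D.omega α, y ≠ p.fact M) → (y ∈ R ↔ y ∈ M.facts)) → ∀ k, k ≠ j →
      ((M.twoSit R M.facts).Models (C k) ↔ M.Models (C k)) := by
    intro M R hR k hk
    rw [Theory.models_iff_twoSit (hu k) α M M.facts]
    refine forall₂_congr fun φ hφ => ?_
    refine Formula.holds_twoSit_congr M φ (hu k φ hφ) (fun y hy => hR y ?_) _ _ _
    rintro p hp rfl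
    exact hj k hk p hp (Theory.mem_sig.2 ⟨φ, hφ, hy⟩)
  have hun : ∀ (M : Str L) (B : J → Theory L), M.Models (⋃ k, B k) ↔ ∀ k, M.Models (B k) := by
    intro M B
    simp only [Str.Models, Set.mem_iUnion]
    exact ⟨fun h k φ hφ => h φ ⟨k, hφ⟩, fun h φ ⟨k, hφ⟩ => h k φ hφ⟩
  intro M
  rw [hun, D.models_prog α D.init_uniform]
  constructor
  · rintro ⟨R, hR, h1, h2⟩ k
    have h3 := (hun _ _).1 ((h.equiv _).1 h2)
    by_cases hk : k = j
    · subst hk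
      rw [Function.update_self]
      exact (D.models_prog α (hu k) M).2 ⟨R, hR, h1, h3 k⟩
    · rw [Function.update_of_ne hk]
      exact (hother M R hR k hk).1 (h3 k)
  · intro h3
    have h4 := h3 j
    rw [Function.update_self] at h4
    obtain ⟨R, hR, h1, h2⟩ := (D.models_prog α (hu j) M).1 h4
    -- The earlier facts obtained from `C j` alone serve as the earlier facts for the whole initial
    -- theory.
    refine ⟨R, hR, h1, (h.equiv _).2 ((hun _ _).2 fun k => ?_)⟩
    by_cases hk : k = j
    · rwa [hk]
    · refine (hother M R hR k hk).2 ?_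
      have h5 := h3 k
      rwa [Function.update_of_ne hk] at h5

/-- Progressing a component leaves its fluent-free consequences unchanged, so any fluent-free `Δ` is
allowed. This covers `Δ₂` and `Δ_β` alike. -/
theorem PairwiseInseparable.update_prog [DecidableEq J] {Δ : Set (Symb L)} (hΔ : FluentFree Δ)
    (hu : ∀ j, ∀ φ ∈ C j, Formula.Uniform φ .s0) (j : J) (h : PairwiseInseparable Δ C) :
    PairwiseInseparable Δ (Function.update C j (D.prog α (C j))) := by
  have h1 : ∀ k (φ : Sentence L), φ.sig ⊆ Δ →
      ((Function.update C j (D.prog α (C j)) k).Entails φ ↔ (C k).Entails φ) := by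
    intro k φ hφ
    by_cases hk : k = j
    · subst hk
      rw [Function.update_self]
      exact D.entails_prog_iff α (hu k) fun F hF => hΔ F (hφ hF)
    · rw [Function.update_of_ne hk]
  exact fun k l hkl φ hφ => (h1 k φ hφ).trans ((h k l hkl φ hφ).trans (h1 l φ hφ).symm)

/-- Strong preservation of the components of the initial theory in a progression. -/
theorem StrongPreservationConditions.exists_progress
    (h : StrongPreservationConditions D α Δ₁ Δ₂ DI C) :
    ∃ C' : J → Theory L,
      IsDecomposition Δ₂ (D.progress α).init C' ∧
      (∀ Δ, FluentFree Δ → PairwiseInseparable Δ C → PairwiseInseparable Δ C') ∧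
      (∀ β : GroundAction L,
        (PreservationConditions D β Δ₁ Δ₂ DI C →
          PreservationConditions (D.progress α) β Δ₁ Δ₂ DI C') ∧
        (StrongPreservationConditions D β Δ₁ Δ₂ DI C →
          StrongPreservationConditions (D.progress α) β Δ₁ Δ₂ DI C')) := by
  classical
  obtain ⟨i, j, hij, hΩ, hc⟩ := h.exists_component
  have hdec := h.decomposition
  let N := D.instSig α
  have hdo : Symb.doSym ∉ N := D.doSym_notMem_instSig α
  have hN : ∀ x ∈ N, x ∈ (C j).sig ∨ x ∈ (DI i).sig := by
    intro x hx
    obtain ⟨p, hp, hx⟩ := D.instSig_subset α hx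
    obtain ⟨h1, h2⟩ := hc ⟨p, hp⟩
    rcases hx with rfl | hx | hx
    · exact Or.inl h2
    · exact Or.inl (h1 hx)
    · exact Or.inr (Theory.mem_sig.2 ⟨_, hΩ p hp, hx⟩)
  -- A symbol of the affected group that is already in the initial theory lies in `C j` by
  -- alignment.
  have hNinit : ∀ x ∈ N, x ∈ D.init.sig → x ∈ (C j).sig := fun x hx h1 =>
    (hN x hx).elim id fun h2 => hij ⟨h2, h1⟩
  have hinit : (D.progress α).init = D.prog α D.init := rfl
  have hsig_init : (D.progress α).init.sig = D.init.sig ∪ N := D.sig_prog α D.init_uniform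
  have hsig_j : (D.prog α (C j)).sig = (C j).sig ∪ N := D.sig_prog α (h.uniform j)
  let C' := Function.update C j (D.prog α (C j))
  have hC'j : (C' j).sig = (C j).sig ∪ N := by
    rw [← hsig_j]
    exact congrArg Theory.sig (Function.update_self ..)
  have hC' : ∀ k, k ≠ j → C' k = C k := fun k hk => Function.update_of_ne hk ..
  have hsub : ∀ k, (C k).sig ⊆ (C' k).sig := by
    intro k
    by_cases hk : k = j
    · rw [hk, hC'j]
      exact Set.subset_union_left
    · rw [hC' k hk]
  -- No component acquires an old symbol: whatever it gains is new to the whole initial theory.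
  -- Hence the pairwise intersections do not grow.
  have hsup : ∀ k, (C' k).sig ∩ D.init.sig ⊆ (C k).sig := by
    intro k
    by_cases hk : k = j
    · rw [hk, hC'j]
      rintro x ⟨h1 | h1, h2⟩
      · exact h1
      · exact hNinit x h1 h2
    · rw [hC' k hk]
      exact Set.inter_subset_left
  have hinter : ∀ k, k ≠ j → (C' j).sig ∩ (C' k).sig = Δ₂ := by
    intro k hk
    rw [hC' k hk, ← hdec.inter_eq j k hk.symm]
    refine Set.Subset.antisymm (fun x hx => ⟨hsup j ⟨hx.1, hdec.sig_subset k hx.2⟩, hx.2⟩)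
      fun x hx => ⟨hsub j hx.1, hx.2⟩
  have hdec' : IsDecomposition Δ₂ (D.progress α).init C' := by
    refine ⟨hdec.nontrivial, ?_, ?_, ?_, ?_, ?_⟩
    · rw [hsig_init]
      exact hdec.subset_sig.trans Set.subset_union_left
    · intro k l hkl
      by_cases hk : k = j
      · subst hk
        exact hinter l hkl.symm
      · by_cases hl : l = j
        · subst hl
          rw [Set.inter_comm]
          exact hinter k hk
        · rw [hC' k hk, hC' l hl]
          exact hdec.inter_eq k l hkl
    · intro k hk
      -- Components only grow and contain `Δ₂` from the start, so one that now equals `Δ₂` would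
      -- have equalled it before.
      exact hdec.sig_ne k (((hsub k).trans hk.subset).antisymm (hdec.subset_sig_component k))
    · rw [hsig_init, ← hdec.union_eq]
      refine Set.Subset.antisymm (Set.iUnion_subset fun k => ?_)
        (Set.union_subset (Set.iUnion_mono hsub) ?_)
      · by_cases hk : k = j
        · rw [hk, hC'j]
          exact Set.union_subset_union_left _ (Set.subset_iUnion (fun j => (C j).sig) j)
        · rw [hC' k hk]
          exact (Set.subset_iUnion (fun j => (C j).sig) k).trans Set.subset_union_left
      · refine subset_trans ?_ (Set.subset_iUnion (fun k => (C' k).sig) j)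
        rw [hC'j]
        exact Set.subset_union_right
    · rw [hinit]
      -- An affected fluent is in `C j`; in another component it would lie in the intersection `Δ₂`,
      -- which is fluent-free.
      refine hdec.equiv_prog h.uniform fun k hk p hp hF => ?_
      have h1 : Symb.fluent p.1 ∈ (C j).sig := by
        refine hNinit _ (Set.mem_iUnion₂.2 ⟨p, hp, Or.inl ?_⟩) (h.fluent_mem_init p.1)
        rw [GroundAtom.sig_toFormula]
        exact Or.inl (Or.inl rfl)
      refine h.fluentFree₂ p.1 ?_
      rw [← hdec.inter_eq k j hk]
      exact ⟨hF, h1⟩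
  have hP : ∀ β : GroundAction L, PreservationConditions D β Δ₁ Δ₂ DI C →
      PreservationConditions (D.progress α) β Δ₁ Δ₂ DI C' := by
    intro β hβ
    refine ⟨hβ.localEffect, hβ.fluentFree₁, hβ.fluentFree₂, hβ.do_notMem₁, hβ.do_notMem₂,
      hβ.nonempty, hβ.ss_eq, hβ.ss_inter, hdec', fun k => ?_, fun k => ?_, fun k => ?_,
      fun F hF => ?_, fun l => ?_⟩
    · by_cases hk : k = j
      · rw [hk]
        simpa only [C', Function.update_self] using D.finite_prog α (hβ.finite j)
      · rw [hC' k hk]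
        exact hβ.finite k
    · by_cases hk : k = j
      · rw [hk]
        simpa only [C', Function.update_self] using D.uniform_prog α (hβ.uniform j)
      · rw [hC' k hk]
        exact hβ.uniform k
    · exact (hβ.sig_diff k).mono (Set.sdiff_subset_sdiff_left (hsub k))
    · rw [hsig_init]
      exact Or.inl (hβ.fluents F hF)
    · rw [hsig_init]
      by_cases hl : l = i
      · refine ⟨j, ?_⟩
        rw [hl, hC'j]
        rintro x ⟨h1, h2 | h2⟩
        · exact Or.inl (hij ⟨h1, h2⟩)
        · exact Or.inr h2
      · obtain ⟨k, hk⟩ := hβ.aligned l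
        refine ⟨k, ?_⟩
        rintro x ⟨h1, h2⟩
        by_cases h3 : x ∈ D.init.sig
        · exact hsub k (hk ⟨h1, h3⟩)
        · have h2 : x ∈ N := h2.resolve_left h3
          rcases hN x h2 with h4 | h4
          · exact (h3 (hdec.sig_subset j h4)).elim
          -- A new symbol comes from group `i`; if group `l` also has it, it is in `Δ₁ ⊆ Δ₂`, hence
          -- in every component, or it is `do`, which is never new.
          · rcases hβ.ss_inter l i hl ⟨h1, h4⟩ with h5 | h5
            · exact hsub k (hdec.subset_sig_component k (h.subset h5))
            · rw [Set.mem_singleton_iff.1 h5] at h2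
              exact (hdo h2).elim
  refine ⟨C', hdec', fun Δ hΔ => PairwiseInseparable.update_prog hΔ h.uniform j, fun β =>
    ⟨hP β, fun hβ => ⟨hP β hβ.toPreservationConditions, hβ.no_action, fun k F hF hA => ?_,
      hβ.subset⟩⟩⟩
  -- A fluent of a new component is an old symbol, so it was in that component before, and its
  -- constants were already there.
  exact (hβ.consts_subset k F (hsup k ⟨hF, hβ.fluent_mem_init F⟩) hA).trans (hsub k)

/-- Each step preserves the strong conditions for all remaining actions simultaneously, with the
same `Δ₁`, `Δ₂` and groups. The decomposition is a separate hypothesis because an empty list of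
actions provides no conditions to extract it from. -/
theorem exists_decomposition_foldl_progress (βs : List (GroundAction L)) (D : BAT L)
    (C : J → Theory L) (hD : IsDecomposition Δ₂ D.init C)
    (h : ∀ β ∈ βs, StrongPreservationConditions D β Δ₁ Δ₂ DI C) :
    ∃ C' : J → Theory L, IsDecomposition Δ₂ (βs.foldl BAT.progress D).init C' ∧
      (PairwiseInseparable Δ₂ C → PairwiseInseparable Δ₂ C') := by
  induction βs generalizing D C with
  | nil => exact ⟨C, hD, id⟩
  | cons β βs ih =>
    have hβ := h β (by simp)
    obtain ⟨C₁, h1, h2, h3⟩ := hβ.exists_progress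
    obtain ⟨C', h4, h5⟩ := ih (D.progress β) C₁ h1 fun β' hβ' =>
      (h3 β').2 (h β' (List.mem_cons_of_mem _ hβ'))
    exact ⟨C', h4, fun hC => h5 (h2 Δ₂ hβ.fluentFree₂ hC)⟩

end Preservation

end SitCalc

theorem mainTheorem3 {L : SitLang} [Finite L.Fluent] (D : BAT L) (α : GroundAction L)
    (Δ₁ Δ₂ : Set (Symb L)) {I J : Type*} (DI : I → Theory L) (C : J → Theory L)
    (h : StrongPreservationConditions D α Δ₁ Δ₂ DI C) :
    (∃ C' : J → Theory L,
      IsDecomposition Δ₂ ((D.progression α).replaceSit α.sit .s0) C' ∧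
      (PairwiseInseparable Δ₂ C → PairwiseInseparable Δ₂ C') ∧
      (∀ β : GroundAction L,
        (PreservationConditions D β Δ₁ Δ₂ DI C →
          PreservationConditions (D.progress α) β Δ₁ Δ₂ DI C') ∧
        (PairwiseInseparable (Δ₁ ∪ Δ₂ ∪ β.consts) C →
          PairwiseInseparable (Δ₁ ∪ Δ₂ ∪ β.consts) C') ∧
        (StrongPreservationConditions D β Δ₁ Δ₂ DI C →
          StrongPreservationConditions (D.progress α) β Δ₁ Δ₂ DI C'))) ∧
    (∀ βs : List (GroundAction L),
      (∀ β ∈ βs, StrongPreservationConditions D β Δ₁ Δ₂ DI C) →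
      ∃ C' : J → Theory L,
        IsDecomposition Δ₂ (βs.foldl BAT.progress D).init C' ∧
        (PairwiseInseparable Δ₂ C → PairwiseInseparable Δ₂ C')) := by
  obtain ⟨C', h1, h2, h3⟩ := h.exists_progress
  exact ⟨⟨C', h1, h2 Δ₂ h.fluentFree₂, fun β =>
    ⟨(h3 β).1, h2 _ (h.fluentFree₁.union_consts h.fluentFree₂ β), (h3 β).2⟩⟩,
    fun βs hβs => exists_decomposition_foldl_progress βs D C h.decomposition hβs⟩
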